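/- Let $m,s\ge 2$ be integers, let $X=\{0,1,\dots,m-1\}$, and let $T$ be the $m$-adic rooted tree, whose vertices are the finite words over $X$ (the root is the empty word, and the children of a word $\omega$ are the words $\omega x$ with $x\in X$). For $f\in\operatorname{Aut}T$ and a letter $x\in X$ let $f^{\epsilon}\in\operatorname{Sym}(X)$ be the permutation of the letters induced by $f$ at the root, and let $f_x\in\operatorname{Aut}T$ be the section of $f$ at $x$, so that $f(xw)=f^{\epsilon}(x)\,f_x(w)$ for every word $w$. We write $f=(f_0,\dots,f_{m-1})f^{\epsilon}$. Let $\mathcal{O}_m=\langle c\rangle\le\operatorname{Aut}T$ be the $m$-adic odometer, where $c=(1,\dots,1,c)\sigma$ and $\sigma=(0\;1\;\cdots\;m-1)$. Let $\beta_i^s:\operatorname{Aut}T\to\operatorname{Aut}T$, for $0\le i\le s-1$, be the maps determined by $$\beta_i^s(g)=(1,\dots,1,\beta_{i-1}^s(g))\quad(1\le i\le s-1),\qquad \beta_0^s(g)=(\beta_{s-1}^s(g_0),\dots,\beta_{s-1}^s(g_{m-1}))\,g^{\epsilon}.$$ Let $G=\mathrm{Bas}_s(\mathcal{O}_m)=\langle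 \beta_i^s(g) : g\in\mathcal{O}_m,\ 0\le i\le s-1\rangle\le\operatorname{Aut}T$ be the generalised Basilica group. If $H$ is a prodense subgroup of $G$, that is, a subgroup such that $HN=G$ for every nontrivial normal subgroup $N$ of $G$, then $H=G$. -/

import Mathlib

open scoped Pointwise

/-- The automorphism group of the rooted `m`-adic tree. The vertices are the words over the alphabet
`{0, …, m-1}`, the root is the empty word, and `u` precedes `v` when `u` is a prefix of `v`. The
automorphisms are the bijections of the vertices preserving levels and precedence. -/
def TreeAut (m : ℕ) : Subgroup (Equiv.Perm (List (Fin m))) where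
  carrier := {f | (∀ u, (f u).length = u.length) ∧ ∀ u v, f u <+: f v ↔ u <+: v}
  one_mem' := ⟨fun _ => rfl, fun _ _ => Iff.rfl⟩
  mul_mem' := by
    rintro f g ⟨hf, hf'⟩ ⟨hg, hg'⟩
    exact ⟨fun u => by simp [hf, hg], fun u v => by simp [hf', hg']⟩
  inv_mem' := by
    rintro f ⟨hf, hf'⟩
    refine ⟨fun u => ?_, fun u v => ?_⟩
    · rw [← hf (f⁻¹ u), Equiv.Perm.inv_def, Equiv.apply_symm_apply]
    · rw [← hf', Equiv.Perm.inv_def, Equiv.apply_symm_apply, Equiv.apply_symm_apply]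

namespace TreeAut

variable {m : ℕ}

theorem length_apply (f : TreeAut m) (u : List (Fin m)) : (f.1 u).length = u.length := f.2.1 u

theorem prefix_iff (f : TreeAut m) (u v : List (Fin m)) : f.1 u <+: f.1 v ↔ u <+: v := f.2.2 u v

theorem apply_append (f : TreeAut m) (u v : List (Fin m)) :
    f.1 u ++ (f.1 (u ++ v)).drop u.length = f.1 (u ++ v) := by
  obtain ⟨w, hw⟩ := (prefix_iff f u (u ++ v)).2 (List.prefix_append u v)
  rw [← hw, ← length_apply f u, List.drop_left]

theorem inv_append (f : TreeAut m) (u v : List (Fin m)) :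
    u ++ (f.1.symm (f.1 u ++ v)).drop u.length = f.1.symm (f.1 u ++ v) := by
  have h : u <+: f.1.symm (f.1 u ++ v) := by
    rw [← prefix_iff f, Equiv.apply_symm_apply]
    exact List.prefix_append _ _
  obtain ⟨w, hw⟩ := h
  rw [← hw, List.drop_left]

/-- The section `f_u` of `f` at the vertex `u`: the automorphism with `f (u v) = f (u) f_u (v)`
(this identity is `apply_append`). -/
def sectionAt (f : TreeAut m) (u : List (Fin m)) : TreeAut m :=
  ⟨{ toFun := fun v => (f.1 (u ++ v)).drop u.length
     invFun := fun v => (f.1.symm (f.1 u ++ v)).drop u.length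
     left_inv := fun v => by
       change (f.1.symm (f.1 u ++ (f.1 (u ++ v)).drop u.length)).drop u.length = v
       rw [apply_append, Equiv.symm_apply_apply, List.drop_left]
     right_inv := fun v => by
       change (f.1 (u ++ (f.1.symm (f.1 u ++ v)).drop u.length)).drop u.length = v
       rw [inv_append, Equiv.apply_symm_apply, ← length_apply f u, List.drop_left] },
   fun v => by
     change ((f.1 (u ++ v)).drop u.length).length = v.length
     simp [length_apply],
   fun v w => by
     change (f.1 (u ++ v)).drop u.length <+: (f.1 (u ++ w)).drop u.length ↔ v <+: w
     rw [← List.prefix_append_right_inj (f.1 u), apply_append, apply_append, prefix_iff,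
       List.prefix_append_right_inj]⟩

theorem apply_singleton (f : TreeAut m) (x : Fin m) : ∃ y, f.1 [x] = [y] :=
  List.length_eq_one_iff.1 (length_apply f [x])

theorem singleton_ne_nil (f : TreeAut m) (x : Fin m) : f.1 [x] ≠ [] := by
  obtain ⟨y, hy⟩ := apply_singleton f x
  simp [hy]

theorem apply_singleton_head (f : TreeAut m) (x : Fin m) :
    [(f.1 [x]).head (singleton_ne_nil f x)] = f.1 [x] := by
  obtain ⟨y, hy⟩ := apply_singleton f x
  simp [hy]

/-- The permutation `f^ε` of the letters induced by `f` at the root. -/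
def rootPerm (f : TreeAut m) : Equiv.Perm (Fin m) where
  toFun x := (f.1 [x]).head (singleton_ne_nil f x)
  invFun x := ((f⁻¹).1 [x]).head (singleton_ne_nil f⁻¹ x)
  left_inv x := by
    apply List.singleton_injective
    simp [apply_singleton_head]
  right_inv x := by
    apply List.singleton_injective
    change [(f.1 [((f⁻¹).1 [x]).head (singleton_ne_nil f⁻¹ x)]).head _] = [x]
    rw [apply_singleton_head, apply_singleton_head f⁻¹ x]
    exact Equiv.apply_symm_apply f.1 [x]

section Recursion

variable {Q : Type} (π : Q → Equiv.Perm (Fin m)) (δ : Q → Fin m → Q)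

/-- The map on words given by the recursion `q ↦ (δ q 0, …, δ q (m-1)) π q`. -/
def recMap : Q → List (Fin m) → List (Fin m)
  | _, [] => []
  | q, x :: w => π q x :: recMap (δ q x) w

/-- The inverse of `recMap π δ q`. -/
def recInv : Q → List (Fin m) → List (Fin m)
  | _, [] => []
  | q, y :: w => (π q).symm y :: recInv (δ q ((π q).symm y)) w

theorem recInv_recMap (w : List (Fin m)) : ∀ q, recInv π δ q (recMap π δ q w) = w := by
  induction w with
  | nil => exact fun _ => rfl
  | cons x w ih => exact fun q => by simp [recMap, recInv, ih]

theorem recMap_recInv (w : List (Fin m)) : ∀ q, recMap π δ q (recInv π δ q w) = w := by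
  induction w with
  | nil => exact fun _ => rfl
  | cons x w ih => exact fun q => by simp [recMap, recInv, ih]

theorem length_recMap (w : List (Fin m)) : ∀ q, (recMap π δ q w).length = w.length := by
  induction w with
  | nil => exact fun _ => rfl
  | cons x w ih => exact fun q => by simp [recMap, ih]

theorem recMap_prefix (u : List (Fin m)) :
    ∀ q v, recMap π δ q u <+: recMap π δ q v ↔ u <+: v := by
  induction u with
  | nil => simp [recMap]
  | cons x u ih =>
    intro q v
    cases v with
    | nil => simp [recMap]
    | cons y v =>
      simp only [recMap, List.cons_prefix_cons, EmbeddingLike.apply_eq_iff_eq]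
      constructor
      · rintro ⟨rfl, h⟩
        exact ⟨rfl, (ih _ _).1 h⟩
      · rintro ⟨rfl, h⟩
        exact ⟨rfl, (ih _ _).2 h⟩

/-- The family of automorphisms defined by the simultaneous recursion
`q = (δ q 0, …, δ q (m-1)) π q`, where `(g_0, …, g_{m-1}) τ` denotes the automorphism
`x w ↦ τ(x) g_x(w)`. -/
def ofRecursion (q : Q) : TreeAut m :=
  ⟨{ toFun := recMap π δ q
     invFun := recInv π δ q
     left_inv := fun w => recInv_recMap π δ w q
     right_inv := fun w => recMap_recInv π δ w q },
   fun w => length_recMap π δ w q, fun u v => recMap_prefix π δ u q v⟩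

end Recursion

variable (m) in
/-- The generator `c = (1, …, 1, c) σ` of the `m`-adic odometer, `σ = (0 1 ⋯ m-1)`. The state `true`
of the recursion is `c` and the state `false` is the identity. -/
def odometer : TreeAut m :=
  ofRecursion (Q := Bool) (fun q => if q then finRotate m else 1)
    (fun q x => q && decide ((x : ℕ) + 1 = m)) true

variable (m) in
/-- The `m`-adic odometer `O_m`, the cyclic group generated by `c`. -/
def odometerGroup : Subgroup (TreeAut m) := Subgroup.zpowers (odometer m)

/-- The permutations at the root in the recursion for `β_i^s(g)`; the state `some (i, g)` stands for
`β_i^s(g)` and the state `none` for the identity. -/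
def betaPerm : Option (ℕ × TreeAut m) → Equiv.Perm (Fin m)
  | none => 1
  | some (0, g) => rootPerm g
  | some (_ + 1, _) => 1

/-- The first-level sections in the recursion for `β_i^s(g)`. -/
def betaNext (s : ℕ) : Option (ℕ × TreeAut m) → Fin m → Option (ℕ × TreeAut m)
  | none, _ => none
  | some (0, g), x => some (s - 1, sectionAt g [x])
  | some (i + 1, g), x => if (x : ℕ) + 1 = m then some (i, g) else none

/-- The maps `β_i^s : Aut T → Aut T`, given by
`β_i^s(g) = (1, …, 1, β_{i-1}^s(g))` for `1 ≤ i ≤ s - 1` and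
`β_0^s(g) = (β_{s-1}^s(g_0), …, β_{s-1}^s(g_{m-1})) g^ε`. -/
def beta (s i : ℕ) (g : TreeAut m) : TreeAut m :=
  ofRecursion betaPerm (betaNext s) (some (i, g))

theorem recMap_beta_none (s : ℕ) (w : List (Fin m)) :
    recMap betaPerm (betaNext s) none w = w := by
  induction w with
  | nil => rfl
  | cons x w ih => simp [recMap, betaPerm, betaNext, ih]

/-- The defining equation of `β_0^s(g)`. -/
theorem beta_zero_cons (s : ℕ) (g : TreeAut m) (x : Fin m) (w : List (Fin m)) :
    (beta s 0 g).1 (x :: w) = rootPerm g x :: (beta s (s - 1) (sectionAt g [x])).1 w := rfl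

/-- The defining equation of `β_{i+1}^s(g)`. -/
theorem beta_succ_cons (s i : ℕ) (g : TreeAut m) (x : Fin m) (w : List (Fin m)) :
    (beta s (i + 1) g).1 (x :: w) =
      x :: if (x : ℕ) + 1 = m then (beta s i g).1 w else w := by
  change x :: recMap betaPerm (betaNext s) (betaNext s (some (i + 1, g)) x) w = _
  by_cases h : (x : ℕ) + 1 = m
  · simp [betaNext, h, beta, ofRecursion]
  · simp [betaNext, h, recMap_beta_none]

/-- The defining equation of the odometer. -/
theorem odometer_cons (x : Fin m) (w : List (Fin m)) :
    (odometer m).1 (x :: w) =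
      finRotate m x :: if (x : ℕ) + 1 = m then (odometer m).1 w else w := by
  have h1 : ∀ w : List (Fin m), recMap (fun q : Bool => if q then finRotate m else 1)
      (fun q x => q && decide ((x : ℕ) + 1 = m)) false w = w := by
    intro w
    induction w with
    | nil => rfl
    | cons x w ih => simpa [recMap] using ih
  change finRotate m x :: recMap (fun q : Bool => if q then finRotate m else 1)
      (fun q x => q && decide ((x : ℕ) + 1 = m)) (true && decide ((x : ℕ) + 1 = m)) w = _
  by_cases h : (x : ℕ) + 1 = m
  · simp [h, odometer, ofRecursion]
  · simp [h, h1]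

/-- The `s`-th Basilica group `Bas_s(G) = ⟨β_i^s(g) : g ∈ G, 0 ≤ i ≤ s - 1⟩` of a subgroup `G`. -/
def basilica (s : ℕ) (G : Subgroup (TreeAut m)) : Subgroup (TreeAut m) :=
  Subgroup.closure {h | ∃ g ∈ G, ∃ i < s, h = beta s i g}

end TreeAut

/-- A subgroup `H` of `G` is prodense if `HN = G` for every nontrivial normal subgroup `N` of `G`. -/
def IsProdense {G : Type*} [Group G] (H : Subgroup G) : Prop :=
  ∀ N : Subgroup G, N.Normal → N ≠ ⊥ → (H : Set G) * (N : Set G) = Set.univ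

/-! Write a_i (`gen d i`, with i modulo s) for β_i(c), and G for the group they generate. The
section of a_i at the last letter is a_{i-1}, its other first-level sections are trivial, and only
a_0 moves letters, as an m-cycle. It suffices to find a vertex at which the sections of the elements
of H fixing it form all of G; the proof lifts this property to H and then finds such a vertex.

Lifting (`eq_of_secGroup_eq`). G is weakly regular branch over G', so section groups of a prodense H
are again prodense. Suppose H has full section group at a letter x. Commutators of elements whose
sections vanish at different letters give an element of H supported below x only; the strict descent
of the derived series makes a nontrivial choice possible. The translates of such elements generate a
nontrivial normal subgroup N of G inside H, and H = HN = G.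

Finding the vertex, first step (`Subgroup.ProdenseIn.exists_occurs`). As HG' = G, some word with all
exponent sums 1 represents an element of H. Such a word acts as the m-cycle on the first level, and
its m-th power has as section at 0 a rearrangement of the same letters with indices lowered by one.
In a word of minimal length, up to conjugacy and passage to sections, no inverse letter can survive,
so a conjugate of a product of all the a_i in some order lies in a section group.

Second step (`GenCycle.exists_linkedAt`, `GenCycle.exists_secGroup_eq`). Let K be the conjugated
section group containing this product. Its partial products t_i satisfy t_{ν(i)} a_i t_i⁻¹ ∈ K for a
transitive ν. Regard two indices as linked when K carries the subtree below a deep vertex of the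
rightmost ray, embedded by one t_i, rigidly onto its copy embedded by another. By contraction
(`contracts`), deep sections of elements of K are nucleus elements, and each changes the indicator
of a link class as prescribed by its exponent sums. An element of K permutes a level, so the total
change is 0; testing this on elements with the exponent sums of a single a_i links all the indices.
Then every generator is a section of K at one vertex. Lifting applied to K and then to H finishes
the proof. -/

namespace TreeAut

/-! ### Sections, root permutations, grafts and section groups. -/

section Basic

variable {m : ℕ}

theorem ext_apply {f g : TreeAut m} (h : ∀ w, f.1 w = g.1 w) : f = g :=
  Subtype.ext (Equiv.ext h)

theorem mul_apply (f g : TreeAut m) (w : List (Fin m)) : (f * g).1 w = f.1 (g.1 w) := rfl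

@[simp] theorem one_apply (w : List (Fin m)) : (1 : TreeAut m).1 w = w := rfl

@[simp] theorem inv_apply_self (f : TreeAut m) (w : List (Fin m)) : (f⁻¹).1 (f.1 w) = w :=
  Equiv.symm_apply_apply f.1 w

@[simp] theorem apply_inv_self (f : TreeAut m) (w : List (Fin m)) : f.1 ((f⁻¹).1 w) = w :=
  Equiv.apply_symm_apply f.1 w

@[simp] theorem apply_nil (f : TreeAut m) : f.1 [] = [] :=
  List.length_eq_zero_iff.1 (length_apply f [])

theorem apply_append' (f : TreeAut m) (u v : List (Fin m)) :
    f.1 (u ++ v) = f.1 u ++ (sectionAt f u).1 v :=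
  (apply_append f u v).symm

theorem apply_singleton_eq (f : TreeAut m) (x : Fin m) : f.1 [x] = [rootPerm f x] :=
  (apply_singleton_head f x).symm

theorem rootPerm_eq_of {f : TreeAut m} {x y : Fin m} (h : f.1 [x] = [y]) : rootPerm f x = y := by
  rw [apply_singleton_eq] at h
  exact List.singleton_injective h

theorem apply_cons (f : TreeAut m) (x : Fin m) (w : List (Fin m)) :
    f.1 (x :: w) = rootPerm f x :: (sectionAt f [x]).1 w := by
  have := apply_append' f [x] w
  rwa [apply_singleton_eq] at this

theorem sectionAt_eq {f g : TreeAut m} {u v : List (Fin m)} (h : ∀ w, f.1 (u ++ w) = v ++ g.1 w) :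
    sectionAt f u = g := by
  apply ext_apply
  intro w
  have h0 : f.1 u = v := by simpa using h []
  have h1 := h w
  rw [apply_append', h0] at h1
  exact List.append_cancel_left h1

@[simp] theorem sectionAt_nil (f : TreeAut m) : sectionAt f [] = f :=
  sectionAt_eq (v := []) fun _ => rfl

@[simp] theorem sectionAt_one (u : List (Fin m)) : sectionAt (1 : TreeAut m) u = 1 :=
  sectionAt_eq (v := u) fun _ => rfl

theorem sectionAt_mul (f g : TreeAut m) (u : List (Fin m)) :
    sectionAt (f * g) u = sectionAt f (g.1 u) * sectionAt g u :=
  sectionAt_eq (v := f.1 (g.1 u)) fun w => by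
    rw [mul_apply, mul_apply, apply_append', apply_append']

theorem sectionAt_inv (f : TreeAut m) (u : List (Fin m)) :
    sectionAt f⁻¹ u = (sectionAt f ((f⁻¹).1 u))⁻¹ := by
  rw [eq_inv_iff_mul_eq_one]
  have h := sectionAt_mul f⁻¹ f ((f⁻¹).1 u)
  rw [apply_inv_self, inv_mul_cancel, sectionAt_one] at h
  exact h.symm

theorem sectionAt_append (f : TreeAut m) (u v : List (Fin m)) :
    sectionAt f (u ++ v) = sectionAt (sectionAt f u) v :=
  sectionAt_eq (v := f.1 u ++ (sectionAt f u).1 v) fun w => by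
    rw [List.append_assoc, apply_append', apply_append', List.append_assoc]

theorem sectionAt_cons (f : TreeAut m) (x : Fin m) (v : List (Fin m)) :
    sectionAt f (x :: v) = sectionAt (sectionAt f [x]) v :=
  sectionAt_append f [x] v

@[simp] theorem rootPerm_one : rootPerm (1 : TreeAut m) = 1 := by
  ext1 x
  exact rootPerm_eq_of rfl

theorem rootPerm_mul (f g : TreeAut m) : rootPerm (f * g) = rootPerm f * rootPerm g := by
  ext1 x
  apply rootPerm_eq_of
  rw [mul_apply, apply_singleton_eq, apply_singleton_eq]
  rfl

theorem rootPerm_inv (f : TreeAut m) : rootPerm f⁻¹ = (rootPerm f)⁻¹ := by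
  rw [eq_inv_iff_mul_eq_one, ← rootPerm_mul, inv_mul_cancel, rootPerm_one]

theorem rootPerm_pow (f : TreeAut m) (n : ℕ) : rootPerm (f ^ n) = rootPerm f ^ n := by
  induction n with
  | zero => simp
  | succ n ih => rw [pow_succ, rootPerm_mul, ih, pow_succ]

theorem sectionAt_mul_letter (f g : TreeAut m) (x : Fin m) :
    sectionAt (f * g) [x] = sectionAt f [rootPerm g x] * sectionAt g [x] := by
  rw [sectionAt_mul, apply_singleton_eq]

theorem sectionAt_inv_letter (f : TreeAut m) (x : Fin m) :
    sectionAt f⁻¹ [x] = (sectionAt f [(rootPerm f)⁻¹ x])⁻¹ := by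
  rw [sectionAt_inv, apply_singleton_eq, rootPerm_inv]

theorem ext_sections {f g : TreeAut m} (h : rootPerm f = rootPerm g)
    (h' : ∀ x, sectionAt f [x] = sectionAt g [x]) : f = g := by
  apply ext_apply
  intro w
  cases w with
  | nil => simp
  | cons x w => rw [apply_cons, apply_cons, h, h']

/-- The recursion for `node`: the state `none` is the root, the state `some f` is `f`. -/
theorem recMap_some (π : Equiv.Perm (Fin m)) (g : Fin m → TreeAut m) (w : List (Fin m)) :
    ∀ f : TreeAut m, recMap (fun q : Option (TreeAut m) => q.elim π rootPerm)
      (fun q x => some (q.elim (g x) fun f => sectionAt f [x])) (some f) w = f.1 w := by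
  induction w with
  | nil => intro f; simp [recMap]
  | cons x w ih => intro f; rw [apply_cons, ← ih]; rfl

/-- The automorphism `(g_0, …, g_{m-1}) π`. -/
def node (π : Equiv.Perm (Fin m)) (g : Fin m → TreeAut m) : TreeAut m :=
  ofRecursion (fun q : Option (TreeAut m) => q.elim π rootPerm)
    (fun q x => some (q.elim (g x) fun f => sectionAt f [x])) none

theorem node_cons (π : Equiv.Perm (Fin m)) (g : Fin m → TreeAut m) (x : Fin m)
    (w : List (Fin m)) : (node π g).1 (x :: w) = π x :: (g x).1 w := by
  rw [← recMap_some π g w (g x)]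
  rfl

@[simp] theorem rootPerm_node (π : Equiv.Perm (Fin m)) (g : Fin m → TreeAut m) :
    rootPerm (node π g) = π := by
  ext1 x
  apply rootPerm_eq_of
  rw [node_cons, apply_nil]

@[simp] theorem sectionAt_node (π : Equiv.Perm (Fin m)) (g : Fin m → TreeAut m) (x : Fin m) :
    sectionAt (node π g) [x] = g x :=
  sectionAt_eq (v := [π x]) fun w => node_cons π g x w

/-- The automorphism acting as `g` on the subtree below the letter `x`, and trivially elsewhere. -/
def graft (x : Fin m) : TreeAut m →* TreeAut m where
  toFun g := node 1 (Pi.mulSingle x g)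
  map_one' := ext_sections (by simp) fun y => by simp
  map_mul' g h := ext_sections (by simp [rootPerm_mul]) fun y => by
    simp [sectionAt_mul_letter, Pi.mulSingle_mul]

@[simp] theorem rootPerm_graft (x : Fin m) (g : TreeAut m) : rootPerm (graft x g) = 1 :=
  rootPerm_node _ _

theorem sectionAt_graft (x y : Fin m) (g : TreeAut m) :
    sectionAt (graft x g) [y] = if y = x then g else 1 := by
  refine (sectionAt_node _ _ _).trans ?_
  rw [Pi.mulSingle_apply]

@[simp] theorem sectionAt_graft_self (x : Fin m) (g : TreeAut m) :
    sectionAt (graft x g) [x] = g := by simp [sectionAt_graft]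

theorem sectionAt_graft_of_ne {x y : Fin m} (h : y ≠ x) (g : TreeAut m) :
    sectionAt (graft x g) [y] = 1 := by simp [sectionAt_graft, h]

theorem graft_injective (x : Fin m) : Function.Injective (graft x) := fun g h hgh => by
  rw [← sectionAt_graft_self x g, hgh, sectionAt_graft_self]

theorem eq_graft {f : TreeAut m} {x : Fin m} (h : rootPerm f = 1)
    (h' : ∀ y, y ≠ x → sectionAt f [y] = 1) : f = graft x (sectionAt f [x]) :=
  ext_sections (by simp [h]) fun y => by
    by_cases hy : y = x
    · simp [hy]
    · rw [h' y hy, sectionAt_graft_of_ne hy]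

theorem mul_graft (f g : TreeAut m) (x : Fin m) :
    f * graft x g =
      graft (rootPerm f x) (sectionAt f [x] * g * (sectionAt f [x])⁻¹) * f := by
  refine ext_sections ?_ fun y => ?_
  · rw [rootPerm_mul, rootPerm_mul, rootPerm_graft, rootPerm_graft, one_mul, mul_one]
  · rw [sectionAt_mul_letter, sectionAt_mul_letter, rootPerm_graft, Equiv.Perm.one_apply]
    by_cases hy : y = x
    · subst hy
      rw [sectionAt_graft_self, sectionAt_graft_self, inv_mul_cancel_right]
    · rw [sectionAt_graft_of_ne hy, sectionAt_graft_of_ne (by simpa using hy), one_mul, mul_one]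

theorem conj_graft (f g : TreeAut m) (x : Fin m) :
    f * graft x g * f⁻¹ =
      graft (rootPerm f x) (sectionAt f [x] * g * (sectionAt f [x])⁻¹) := by
  rw [mul_graft, mul_inv_cancel_right]

/-- The automorphism acting as `g` on the subtree below the vertex `u`, and trivially elsewhere. -/
def graftAt : List (Fin m) → TreeAut m → TreeAut m
  | [], g => g
  | x :: u, g => graft x (graftAt u g)

theorem graftAt_append (u : List (Fin m)) (g : TreeAut m) (w : List (Fin m)) :
    (graftAt u g).1 (u ++ w) = u ++ g.1 w := by
  induction u with
  | nil => rfl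
  | cons x u ih => simp [graftAt, apply_cons, ih]

theorem graftAt_of_not_prefix (g : TreeAut m) (u : List (Fin m)) :
    ∀ w, w.length ≥ u.length → ¬ u <+: w → (graftAt u g).1 w = w := by
  induction u with
  | nil => intro w _ h; simp at h
  | cons x u ih =>
    intro w hl h
    cases w with
    | nil => simp
    | cons y w =>
      simp only [graftAt, apply_cons, rootPerm_graft, Equiv.Perm.one_apply]
      by_cases hy : y = x
      · subst hy
        rw [sectionAt_graft_self, ih w (by simpa using hl) (by simpa using h)]
      · rw [sectionAt_graft_of_ne hy, one_apply]

/-- Conjugating by `f` moves the support of `graftAt u t` below `f u`, a vertex of the same level,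
so the two supports are disjoint. This is the source of all noncommuting pairs below. -/
theorem eq_one_of_commute_graftAt {f t : TreeAut m} {u : List (Fin m)} (hu : f.1 u ≠ u)
    (h : f * graftAt u t = graftAt u t * f) : t = 1 := by
  apply ext_apply
  intro w
  have h1 : (f * graftAt u t).1 (u ++ w) = (graftAt u t * f).1 (u ++ w) := by rw [h]
  rw [mul_apply, mul_apply, graftAt_append, graftAt_of_not_prefix] at h1
  · exact List.append_cancel_left (f.1.injective h1)
  · simp [length_apply]
  · intro hp
    rw [apply_append', List.prefix_iff_eq_take, List.take_append_of_le_length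
      (by simp [length_apply]), ← length_apply f u, List.take_length] at hp
    exact hu hp.symm

theorem exists_apply_ne {f : TreeAut m} (hf : f ≠ 1) : ∃ u, f.1 u ≠ u := by
  by_contra! h
  exact hf (ext_apply h)

/-- The sections at `u` of the elements of `H` fixing `u`. -/
def secGroup (H : Subgroup (TreeAut m)) (u : List (Fin m)) : Subgroup (TreeAut m) where
  carrier := {g | ∃ h ∈ H, h.1 u = u ∧ sectionAt h u = g}
  one_mem' := ⟨1, H.one_mem, rfl, sectionAt_one u⟩
  mul_mem' := by
    rintro _ _ ⟨f, hf, hfu, rfl⟩ ⟨g, hg, hgu, rfl⟩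
    exact ⟨f * g, H.mul_mem hf hg, by rw [mul_apply, hgu, hfu], by rw [sectionAt_mul, hgu]⟩
  inv_mem' := by
    rintro _ ⟨f, hf, hfu, rfl⟩
    have h : (f⁻¹).1 u = u := by conv_lhs => rw [← hfu, inv_apply_self]
    exact ⟨f⁻¹, H.inv_mem hf, h, by rw [sectionAt_inv, h]⟩

theorem mem_secGroup {H : Subgroup (TreeAut m)} {u : List (Fin m)} {g : TreeAut m} :
    g ∈ secGroup H u ↔ ∃ h ∈ H, h.1 u = u ∧ sectionAt h u = g := Iff.rfl

theorem mem_secGroup_letter {H : Subgroup (TreeAut m)} {x : Fin m} {g : TreeAut m} :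
    g ∈ secGroup H [x] ↔ ∃ h ∈ H, rootPerm h x = x ∧ sectionAt h [x] = g := by
  simp [mem_secGroup, apply_singleton_eq]

@[simp] theorem secGroup_nil (H : Subgroup (TreeAut m)) : secGroup H [] = H := by
  ext g
  simp [mem_secGroup]

theorem secGroup_append (H : Subgroup (TreeAut m)) (u v : List (Fin m)) :
    secGroup H (u ++ v) = secGroup (secGroup H u) v := by
  ext g
  constructor
  · rintro ⟨f, hf, hfu, rfl⟩
    rw [apply_append'] at hfu
    have h1 := List.append_inj hfu (length_apply f u)
    exact ⟨sectionAt f u, ⟨f, hf, h1.1, rfl⟩, h1.2, (sectionAt_append f u v).symm⟩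
  · rintro ⟨_, ⟨f, hf, hfu, rfl⟩, hv, rfl⟩
    exact ⟨f, hf, by rw [apply_append', hfu, hv], sectionAt_append f u v⟩

theorem secGroup_cons (H : Subgroup (TreeAut m)) (x : Fin m) (v : List (Fin m)) :
    secGroup H (x :: v) = secGroup (secGroup H [x]) v :=
  secGroup_append H [x] v

end Basic

/-! ### The generators a_i, their sections, and self-replication. -/

section Generators

set_option linter.unusedSectionVars false

open scoped Fin.NatCast Fin.CommRing

theorem beta_mul {m : ℕ} (s i : ℕ) (g h : TreeAut m) :
    beta s i (g * h) = beta s i g * beta s i h := by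
  apply ext_apply
  intro w
  induction w generalizing i g h with
  | nil => simp
  | cons x w ih =>
    rw [mul_apply]
    cases i with
    | zero =>
      rw [beta_zero_cons, beta_zero_cons, beta_zero_cons, sectionAt_mul_letter, ih, rootPerm_mul]
      rfl
    | succ i =>
      rw [beta_succ_cons, beta_succ_cons, beta_succ_cons]
      split_ifs
      · rw [ih, mul_apply]
      · rfl

/-- `β_i^s` as a group homomorphism. -/
def betaHom {m : ℕ} (s i : ℕ) : TreeAut m →* TreeAut m :=
  MonoidHom.mk' (beta s i) (beta_mul s i)

variable {d : ℕ} {s : ℕ} [NeZero s]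

theorem rootPerm_odometer : rootPerm (odometer (d + 2)) = finRotate (d + 2) := by
  ext1 x
  apply rootPerm_eq_of
  rw [odometer_cons]
  simp

theorem sectionAt_odometer (x : Fin (d + 2)) :
    sectionAt (odometer (d + 2)) [x] = if x = Fin.last (d + 1) then odometer (d + 2) else 1 := by
  refine sectionAt_eq (v := [finRotate (d + 2) x]) fun w => ?_
  have h : (x : ℕ) + 1 = d + 2 ↔ x = Fin.last (d + 1) := by
    rw [Fin.ext_iff, Fin.val_last]; omega
  rw [List.singleton_append, odometer_cons]
  by_cases hx : x = Fin.last (d + 1)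
  · rw [if_pos (h.2 hx), if_pos hx]; rfl
  · rw [if_neg (mt h.1 hx), if_neg hx]; rfl

variable (d) in
/-- The generators `a_i = β_i^s(c)` of the generalised Basilica group of the odometer, with indices
modulo `s`. -/
def gen (i : ZMod s) : TreeAut (d + 2) := beta s i.val (odometer (d + 2))

theorem exists_val_eq_succ {i : ZMod s} (hi : i ≠ 0) : ∃ k, i.val = k + 1 ∧ (i - 1).val = k := by
  obtain ⟨k, hk⟩ := Nat.exists_eq_succ_of_ne_zero (mt (ZMod.val_eq_zero i).1 hi)
  refine ⟨k, hk, ?_⟩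
  have h : i - 1 = ((k : ℕ) : ZMod s) := by
    rw [← ZMod.natCast_zmod_val i, hk]
    push_cast
    ring
  rw [h, ZMod.val_cast_of_lt]
  have := ZMod.val_lt i
  omega

theorem val_zero_sub_one : ((0 : ZMod s) - 1).val = s - 1 := by
  obtain ⟨n, rfl⟩ := Nat.exists_eq_succ_of_ne_zero (NeZero.ne s)
  rw [zero_sub, ZMod.val_neg_one]
  rfl

theorem rootPerm_gen (i : ZMod s) :
    rootPerm (gen d i) = if i = 0 then finRotate (d + 2) else 1 := by
  ext1 x
  apply rootPerm_eq_of
  by_cases hi : i = 0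
  · subst hi
    rw [gen, ZMod.val_zero, beta_zero_cons, rootPerm_odometer, if_pos rfl, apply_nil]
  · obtain ⟨k, hk, -⟩ := exists_val_eq_succ hi
    rw [gen, hk, beta_succ_cons, if_neg hi]
    simp

theorem sectionAt_gen (i : ZMod s) (x : Fin (d + 2)) :
    sectionAt (gen d i) [x] = if x = Fin.last (d + 1) then gen d (i - 1) else 1 := by
  have h : (x : ℕ) + 1 = d + 2 ↔ x = Fin.last (d + 1) := by
    rw [Fin.ext_iff, Fin.val_last]; omega
  by_cases hi : i = 0
  · subst hi
    refine sectionAt_eq (v := [finRotate (d + 2) x]) fun w => ?_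
    rw [List.singleton_append, gen, ZMod.val_zero, beta_zero_cons, rootPerm_odometer,
      sectionAt_odometer, gen, val_zero_sub_one]
    split_ifs
    · rfl
    · rw [show beta s (s - 1) (1 : TreeAut (d + 2)) = 1 from (betaHom s (s - 1)).map_one]
      rfl
  · obtain ⟨k, hk, hk'⟩ := exists_val_eq_succ hi
    refine sectionAt_eq (v := [x]) fun w => ?_
    rw [List.singleton_append, gen, hk, beta_succ_cons, gen, hk']
    by_cases hx : x = Fin.last (d + 1)
    · rw [if_pos (h.2 hx), if_pos hx]; rfl
    · rw [if_neg (mt h.1 hx), if_neg hx]; rfl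

theorem rootPerm_gen_zero : rootPerm (gen d (0 : ZMod s)) = finRotate (d + 2) := by
  rw [rootPerm_gen, if_pos rfl]

theorem rootPerm_gen_of_ne {i : ZMod s} (hi : i ≠ 0) : rootPerm (gen d i) = 1 := by
  rw [rootPerm_gen, if_neg hi]

variable (d s) in
/-- The generalised Basilica group of the odometer, as the group generated by the `a_i`. -/
def genGroup : Subgroup (TreeAut (d + 2)) :=
  Subgroup.closure (Set.range (gen d : ZMod s → TreeAut (d + 2)))

theorem gen_mem (i : ZMod s) : gen d i ∈ genGroup d s :=
  Subgroup.subset_closure ⟨i, rfl⟩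

theorem basilica_odometerGroup : basilica s (odometerGroup (d + 2)) = genGroup d s := by
  apply le_antisymm
  · refine (Subgroup.closure_le _).2 ?_
    rintro _ ⟨g, hg, i, hi, rfl⟩
    obtain ⟨n, rfl⟩ := Subgroup.mem_zpowers_iff.1 hg
    have h1 : beta s i (odometer (d + 2)) ∈ genGroup d s := by
      have := gen_mem (d := d) (i : ZMod s)
      rwa [gen, ZMod.val_cast_of_lt hi] at this
    have h2 : beta s i (odometer (d + 2) ^ n) = beta s i (odometer (d + 2)) ^ n :=
      (betaHom s i).map_zpow _ n
    rw [h2]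
    exact (genGroup d s).zpow_mem h1 n
  · refine (Subgroup.closure_le _).2 ?_
    rintro _ ⟨i, rfl⟩
    exact Subgroup.subset_closure
      ⟨_, Subgroup.mem_zpowers _, i.val, ZMod.val_lt i, rfl⟩

theorem finRotate_apply_eq (x : Fin (d + 2)) : finRotate (d + 2) x = x + 1 :=
  finRotate_apply x

theorem finRotate_pow_apply (k : ℕ) (x : Fin (d + 2)) :
    (finRotate (d + 2) ^ k) x = x + (k : Fin (d + 2)) := by
  induction k with
  | zero => simp
  | succ k ih => rw [pow_succ', Equiv.Perm.mul_apply, ih, finRotate_apply_eq]; push_cast; ring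

theorem exists_finRotate_pow (x y : Fin (d + 2)) : ∃ k : ℕ, (finRotate (d + 2) ^ k) x = y :=
  ⟨(y - x).val, by rw [finRotate_pow_apply, Fin.cast_val_eq_self]; ring⟩

theorem rootPerm_commute {g : TreeAut (d + 2)} (hg : g ∈ genGroup d s) :
    Commute (rootPerm g) (finRotate (d + 2)) := by
  induction hg using Subgroup.closure_induction with
  | mem g hg =>
    obtain ⟨i, rfl⟩ := hg
    rw [rootPerm_gen]
    split_ifs
    · exact Commute.refl _
    · exact Commute.one_left _
  | one => rw [rootPerm_one]; exact Commute.one_left _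
  | mul f g _ _ hf hg => rw [rootPerm_mul]; exact hf.mul_left hg
  | inv g _ hg => rw [rootPerm_inv]; exact hg.inv_left

/-- A permutation commuting with the full cycle is a translation. Hence G acts on the first level
through a regular abelian group, and an element fixing one letter fixes all of them. -/
theorem rootPerm_apply {g : TreeAut (d + 2)} (hg : g ∈ genGroup d s) (x : Fin (d + 2)) :
    rootPerm g x = x + rootPerm g 0 := by
  have h := ((rootPerm_commute hg).pow_right x.val).eq
  have h2 := congrArg (fun π : Equiv.Perm (Fin (d + 2)) => π 0) h
  simp only [Equiv.Perm.mul_apply, finRotate_pow_apply, Fin.cast_val_eq_self, zero_add] at h2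
  rw [h2, add_comm (rootPerm g 0) x]

theorem rootPerm_mul_comm {f g : TreeAut (d + 2)} (hf : f ∈ genGroup d s)
    (hg : g ∈ genGroup d s) : rootPerm f * rootPerm g = rootPerm g * rootPerm f := by
  ext1 x
  rw [Equiv.Perm.mul_apply, Equiv.Perm.mul_apply, rootPerm_apply hf, rootPerm_apply hg x,
    rootPerm_apply hg (rootPerm f x), rootPerm_apply hf x]
  ring

theorem rootPerm_eq_one_of_fixed {g : TreeAut (d + 2)} (hg : g ∈ genGroup d s) {x : Fin (d + 2)}
    (hx : rootPerm g x = x) : rootPerm g = 1 := by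
  rw [rootPerm_apply hg, add_eq_left] at hx
  ext1 y
  rw [rootPerm_apply hg, hx, add_zero, Equiv.Perm.one_apply]

theorem sectionAt_mem_letter {g : TreeAut (d + 2)} (hg : g ∈ genGroup d s) :
    ∀ x, sectionAt g [x] ∈ genGroup d s := by
  induction hg using Subgroup.closure_induction with
  | mem g hg =>
    intro x
    obtain ⟨i, rfl⟩ := hg
    rw [sectionAt_gen]
    split_ifs
    · exact gen_mem _
    · exact one_mem _
  | one => intro x; rw [sectionAt_one]; exact one_mem _
  | mul f g _ _ hf hg => intro x; rw [sectionAt_mul_letter]; exact mul_mem (hf _) (hg _)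
  | inv g _ hg => intro x; rw [sectionAt_inv_letter]; exact inv_mem (hg _)

theorem sectionAt_mem (u : List (Fin (d + 2))) :
    ∀ {g : TreeAut (d + 2)}, g ∈ genGroup d s → sectionAt g u ∈ genGroup d s := by
  induction u with
  | nil => intro g hg; rwa [sectionAt_nil]
  | cons x u ih => intro g hg; rw [sectionAt_cons]; exact ih (sectionAt_mem_letter hg x)

theorem secGroup_le {H : Subgroup (TreeAut (d + 2))} (hH : H ≤ genGroup d s)
    (u : List (Fin (d + 2))) : secGroup H u ≤ genGroup d s := by
  rintro _ ⟨f, hf, -, rfl⟩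
  exact sectionAt_mem u (hH hf)

/-- Moving the base letter changes the group of sections by a conjugation. -/
theorem conj_mem_secGroup {m : ℕ} {H : Subgroup (TreeAut m)} {f g : TreeAut m} {x : Fin m}
    (hf : f ∈ H) (hg : g ∈ secGroup H [x]) :
    sectionAt f [x] * g * (sectionAt f [x])⁻¹ ∈ secGroup H [rootPerm f x] := by
  obtain ⟨h, hh, hx, rfl⟩ := mem_secGroup_letter.1 hg
  refine mem_secGroup_letter.2 ⟨f * h * f⁻¹, mul_mem (mul_mem hf hh) (inv_mem hf), ?_, ?_⟩
  · simp [rootPerm_mul, rootPerm_inv, hx]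
  · simp [sectionAt_mul_letter, sectionAt_inv_letter, rootPerm_inv, hx]

/-- The section groups at two letters of one `H`-orbit are conjugate by a section of an element of
`H`. That section lies in G, so a section group equal to G stays equal to G. -/
theorem secGroup_letter_eq {H : Subgroup (TreeAut (d + 2))} (hH : H ≤ genGroup d s)
    {x : Fin (d + 2)} (hx : secGroup H [x] = genGroup d s) {f : TreeAut (d + 2)} (hf : f ∈ H) :
    secGroup H [rootPerm f x] = genGroup d s := by
  refine le_antisymm (secGroup_le hH _) fun g hg => ?_
  have ht := sectionAt_mem_letter (hH hf) x
  have h := conj_mem_secGroup hf (g := (sectionAt f [x])⁻¹ * g * sectionAt f [x])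
    (by rw [hx]; exact mul_mem (mul_mem (inv_mem ht) hg) ht)
  simpa [mul_assoc] using h

theorem gen_zero_pow_mem (k : ℕ) : gen d (0 : ZMod s) ^ k ∈ genGroup d s :=
  pow_mem (gen_mem 0) k

theorem exists_mem_rootPerm_apply (x y : Fin (d + 2)) :
    ∃ f ∈ genGroup d s, rootPerm f x = y := by
  obtain ⟨k, hk⟩ := exists_finRotate_pow x y
  exact ⟨_, gen_zero_pow_mem k, by rw [rootPerm_pow, rootPerm_gen_zero, hk]⟩

theorem sectionAt_pow_succ {m : ℕ} (f : TreeAut m) (k : ℕ) (x : Fin m) :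
    sectionAt (f ^ (k + 1)) [x] =
      sectionAt f [(rootPerm f ^ k) x] * sectionAt (f ^ k) [x] := by
  rw [pow_succ', sectionAt_mul_letter, rootPerm_pow]

/-- Starting from 0, fewer than m rotations never leave the last letter, the only place where a_0
has a nontrivial section. -/
theorem sectionAt_gen_zero_pow (k : ℕ) (hk : k ≤ d + 1) :
    sectionAt (gen d (0 : ZMod s) ^ k) [0] = 1 := by
  induction k with
  | zero => simp
  | succ k ih =>
    rw [sectionAt_pow_succ, ih (by omega), mul_one, rootPerm_gen_zero, finRotate_pow_apply,
      zero_add, sectionAt_gen, if_neg]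
    intro h
    have := congrArg Fin.val h
    rw [Fin.val_natCast, Fin.val_last, Nat.mod_eq_of_lt (by omega)] at this
    omega

theorem natCast_card_sub_one : ((d + 1 : ℕ) : Fin (d + 2)) = Fin.last (d + 1) :=
  Fin.natCast_eq_last (d + 1)

theorem rootPerm_gen_zero_pow_card : rootPerm (gen d (0 : ZMod s) ^ (d + 2)) = 1 := by
  ext1 x
  rw [rootPerm_pow, rootPerm_gen_zero, finRotate_pow_apply]
  simp

/-- The orbit of 0 meets the last letter exactly once, in the final step. The value at other letters
is the same because a_0^m commutes with a_0^x, which takes 0 to x with trivial section. -/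
theorem sectionAt_gen_zero_pow_card (x : Fin (d + 2)) :
    sectionAt (gen d (0 : ZMod s) ^ (d + 2)) [x] = gen d (-1 : ZMod s) := by
  have h0 : sectionAt (gen d (0 : ZMod s) ^ (d + 2)) [0] = gen d (-1 : ZMod s) := by
    rw [sectionAt_pow_succ, sectionAt_gen_zero_pow _ le_rfl, mul_one, rootPerm_gen_zero,
      finRotate_pow_apply, zero_add, natCast_card_sub_one, sectionAt_gen, if_pos rfl, zero_sub]
  have hx : (rootPerm (gen d (0 : ZMod s) ^ x.val)) 0 = x := by
    rw [rootPerm_pow, rootPerm_gen_zero, finRotate_pow_apply]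
    simp
  have h1 := sectionAt_mul_letter (gen d (0 : ZMod s) ^ (d + 2)) (gen d (0 : ZMod s) ^ x.val) 0
  rw [((Commute.refl (gen d (0 : ZMod s))).pow_pow _ _).eq, sectionAt_mul_letter, h0, hx,
    rootPerm_gen_zero_pow_card, Equiv.Perm.one_apply, sectionAt_gen_zero_pow _ (by have := x.2; omega), one_mul, mul_one] at h1
  exact h1.symm

/-- At the last letter a_i is a section of a_{i+1}, except for a_{-1}: there a_0 moves the letter
and its m-th power replaces it. Transitivity gives the other letters. -/
theorem secGroup_genGroup_letter (x : Fin (d + 2)) :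
    secGroup (genGroup d s) [x] = genGroup d s := by
  have h : secGroup (genGroup d s) [Fin.last (d + 1)] = genGroup d s := by
    refine le_antisymm (secGroup_le le_rfl _) ((Subgroup.closure_le _).2 ?_)
    rintro _ ⟨i, rfl⟩
    by_cases hi : i + 1 = 0
    · refine mem_secGroup_letter.2 ⟨_, gen_zero_pow_mem (d + 2), ?_, ?_⟩
      · rw [rootPerm_gen_zero_pow_card, Equiv.Perm.one_apply]
      · rw [sectionAt_gen_zero_pow_card, eq_neg_of_add_eq_zero_left hi]
    · refine mem_secGroup_letter.2 ⟨_, gen_mem (i + 1), ?_, ?_⟩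
      · rw [rootPerm_gen_of_ne hi, Equiv.Perm.one_apply]
      · rw [sectionAt_gen, if_pos rfl, add_sub_cancel_right]
  obtain ⟨f, hf, hfx⟩ := exists_mem_rootPerm_apply (s := s) (Fin.last (d + 1)) x
  rw [← hfx]
  exact secGroup_letter_eq le_rfl h hf

theorem exists_section_eq {g : TreeAut (d + 2)} (hg : g ∈ genGroup d s) (x : Fin (d + 2)) :
    ∃ f ∈ genGroup d s, rootPerm f x = x ∧ sectionAt f [x] = g := by
  rw [← secGroup_genGroup_letter x] at hg
  exact mem_secGroup_letter.1 hg

end Generators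

end TreeAut

/-! ### The derived series and prodensity inside an ambient group. -/

section DerivedChain

open scoped commutatorElement

variable {Γ : Type*} [Group Γ]

/-- The derived series of a subgroup, inside the ambient group. -/
def Subgroup.derivedChain (H : Subgroup Γ) : ℕ → Subgroup Γ
  | 0 => H
  | n + 1 => ⁅H.derivedChain n, H.derivedChain n⁆

namespace Subgroup

theorem commutator_self_le (H : Subgroup Γ) : ⁅H, H⁆ ≤ H :=
  commutator_le.2 fun _ hg _ hh =>
    H.mul_mem (H.mul_mem (H.mul_mem hg hh) (H.inv_mem hg)) (H.inv_mem hh)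

theorem derivedChain_antitone (H : Subgroup Γ) : Antitone H.derivedChain :=
  antitone_nat_of_succ_le fun n => commutator_self_le (H.derivedChain n)

theorem derivedChain_le (H : Subgroup Γ) (n : ℕ) : H.derivedChain n ≤ H :=
  H.derivedChain_antitone (Nat.zero_le n)

theorem conj_mem_derivedChain {H : Subgroup Γ} (n : ℕ) {g : Γ} (hg : g ∈ H) :
    ∀ {k}, k ∈ H.derivedChain n → g * k * g⁻¹ ∈ H.derivedChain n := by
  induction n with
  | zero => intro k hk; exact mul_mem (mul_mem hg hk) (inv_mem hg)
  | succ n ih =>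
    have h : H.derivedChain (n + 1) ≤
        (H.derivedChain (n + 1)).comap (MulAut.conj g).toMonoidHom := by
      refine commutator_le.2 fun a ha b hb => ?_
      change g * ⁅a, b⁆ * g⁻¹ ∈ H.derivedChain (n + 1)
      rw [conjugate_commutatorElement]
      exact commutator_mem_commutator (ih ha) (ih hb)
    intro k hk
    exact h hk

theorem derivedChain_eq_of_succ_eq {H : Subgroup Γ} {n : ℕ}
    (h : H.derivedChain (n + 1) = H.derivedChain n) (k : ℕ) :
    H.derivedChain (n + k) = H.derivedChain n := by
  induction k with
  | zero => rfl
  | succ k ih =>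
    rw [← add_assoc]
    change ⁅H.derivedChain (n + k), H.derivedChain (n + k)⁆ = _
    rw [ih]
    exact h

/-- A commutator subgroup lies in every subgroup which is normalised by the group and contains the
commutators of the generators. -/
theorem commutator_closure_le {S : Set Γ} {P : Subgroup Γ}
    (hP : ∀ g ∈ closure S, ∀ n ∈ P, g * n * g⁻¹ ∈ P) (hS : ∀ a ∈ S, ∀ b ∈ S, ⁅a, b⁆ ∈ P) :
    ⁅closure S, closure S⁆ ≤ P := by
  have key : ∀ b : Γ, (∀ a ∈ S, ⁅a, b⁆ ∈ P) → ∀ g ∈ closure S, ⁅g, b⁆ ∈ P := by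
    intro b hb g hg
    induction hg using closure_induction with
    | mem a ha => exact hb a ha
    | one => rw [commutatorElement_one_left]; exact one_mem P
    | mul g h hg _ h1 h2 =>
      have : ⁅g * h, b⁆ = g * ⁅h, b⁆ * g⁻¹ * ⁅g, b⁆ := by
        simp only [commutatorElement_def]; group
      rw [this]
      exact mul_mem (hP g hg _ h2) h1
    | inv g hg h1 =>
      have : ⁅g⁻¹, b⁆ = g⁻¹ * ⁅g, b⁆⁻¹ * g⁻¹⁻¹ := by
        simp only [commutatorElement_def]; group
      rw [this]
      exact hP _ (inv_mem hg) _ (inv_mem h1)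
  refine commutator_le.2 fun g hg h hh => key h (fun a ha => ?_) g hg
  rw [← commutatorElement_inv]
  refine inv_mem (key a (fun b hb => ?_) h hh)
  exact hS b hb a ha

/-- `H` is a subgroup of `G` with `H N = G` for all nontrivial normal subgroups `N` of `G`; the
version of `IsProdense` for two subgroups of an ambient group. -/
def ProdenseIn (H G : Subgroup Γ) : Prop :=
  H ≤ G ∧ ∀ N ≤ G, (∀ g ∈ G, ∀ n ∈ N, g * n * g⁻¹ ∈ N) → N ≠ ⊥ → ∀ g ∈ G, ∃ h ∈ H, h⁻¹ * g ∈ N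

end Subgroup

end DerivedChain

namespace TreeAut

/-! ### Branching over the commutator subgroup, and prodensity of section groups. -/

section Branch

open scoped commutatorElement

set_option linter.unusedSectionVars false

variable {d s : ℕ} [NeZero s]

theorem graft_last_gen {i : ZMod s} (hi : i + 1 ≠ 0) :
    graft (Fin.last (d + 1)) (gen d i) = gen d (i + 1) := by
  rw [eq_graft (rootPerm_gen_of_ne hi) fun y hy => by rw [sectionAt_gen, if_neg hy],
    sectionAt_gen, if_pos rfl, add_sub_cancel_right]

theorem commutator_graft {m : ℕ} (x : Fin m) (f g : TreeAut m) (hf : rootPerm f = 1) :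
    ⁅f, graft x g⁆ = graft x ⁅sectionAt f [x], g⁆ := by
  rw [commutatorElement_def, conj_graft, hf, Equiv.Perm.one_apply, ← map_inv, ← map_mul,
    commutatorElement_def]

/-- The group is weakly regular branch over its commutator subgroup. -/
theorem graft_mem_commutator (x : Fin (d + 2)) {g : TreeAut (d + 2)}
    (hg : g ∈ ⁅genGroup d s, genGroup d s⁆) : graft x g ∈ ⁅genGroup d s, genGroup d s⁆ := by
  have hconj : ∀ f ∈ genGroup d s, ∀ n ∈ ⁅genGroup d s, genGroup d s⁆,
      f * n * f⁻¹ ∈ ⁅genGroup d s, genGroup d s⁆ := fun f hf n hn =>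
    Subgroup.conj_mem_derivedChain (H := genGroup d s) 1 hf hn
  have hlast : ⁅genGroup d s, genGroup d s⁆ ≤
      ⁅genGroup d s, genGroup d s⁆.comap (graft (Fin.last (d + 1))) := by
    -- The graft of a_i at the last letter is a_{i+1} unless i = -1. The graft of a_{-1} is avoided
    -- by using a_0^m, which fixes the first level and has section a_{-1}: a commutator with a graft
    -- sees only this one section.
    have hpow : ∀ i : ZMod s, i + 1 ≠ 0 → ∀ j : ZMod s,
        graft (Fin.last (d + 1)) ⁅gen d j, gen d i⁆ ∈ ⁅genGroup d s, genGroup d s⁆ := by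
      intro i hi j
      by_cases hj : j + 1 = 0
      · rw [eq_neg_of_add_eq_zero_left hj, ← sectionAt_gen_zero_pow_card (Fin.last (d + 1)),
          ← commutator_graft _ _ _ rootPerm_gen_zero_pow_card, graft_last_gen hi]
        exact Subgroup.commutator_mem_commutator (gen_zero_pow_mem _) (gen_mem _)
      · rw [map_commutatorElement, graft_last_gen hi, graft_last_gen hj]
        exact Subgroup.commutator_mem_commutator (gen_mem _) (gen_mem _)
    refine Subgroup.commutator_closure_le (fun f hf n hn => ?_) ?_
    · obtain ⟨f', hf', hx, rfl⟩ := exists_section_eq hf (Fin.last (d + 1))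
      rw [Subgroup.mem_comap] at hn ⊢
      have := hconj f' hf' _ hn
      rwa [conj_graft, hx] at this
    · rintro _ ⟨i, rfl⟩ _ ⟨j, rfl⟩
      rw [Subgroup.mem_comap]
      by_cases hj : j + 1 = 0
      · by_cases hi : i + 1 = 0
        · rw [eq_neg_of_add_eq_zero_left hi, eq_neg_of_add_eq_zero_left hj,
            commutatorElement_self, map_one]
          exact one_mem _
        · rw [← commutatorElement_inv, map_inv]
          exact inv_mem (hpow i hi j)
      · exact hpow j hj i
  -- Conjugation by `f` moves the graft from the last letter to `x` and also conjugates by a section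
  -- of `f`; this is undone beforehand by normality of the commutator subgroup.
  obtain ⟨f, hf, rfl⟩ := exists_mem_rootPerm_apply (s := s) (Fin.last (d + 1)) x
  have ht := sectionAt_mem_letter hf (Fin.last (d + 1))
  have h := hconj _ (inv_mem ht) _ hg
  have h2 := hconj f hf _ (hlast h)
  rw [conj_graft] at h2
  simpa [mul_assoc] using h2

theorem graft_mem_derivedChain (x : Fin (d + 2)) {n : ℕ} (hn : 1 ≤ n) :
    ∀ {g}, g ∈ (genGroup d s).derivedChain n → graft x g ∈ (genGroup d s).derivedChain n := by
  induction n, hn using Nat.le_induction with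
  | base => intro g hg; exact graft_mem_commutator x hg
  | succ n hn ih =>
    have h : (genGroup d s).derivedChain (n + 1) ≤
        ((genGroup d s).derivedChain (n + 1)).comap (graft x) := by
      refine Subgroup.commutator_le.2 fun a ha b hb => ?_
      rw [Subgroup.mem_comap, map_commutatorElement]
      exact Subgroup.commutator_mem_commutator (ih ha) (ih hb)
    intro g hg
    exact h hg

theorem graftAt_mem_derivedChain (u : List (Fin (d + 2))) {n : ℕ} (hn : 1 ≤ n)
    {g : TreeAut (d + 2)} (hg : g ∈ (genGroup d s).derivedChain n) :
    graftAt u g ∈ (genGroup d s).derivedChain n := by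
  induction u with
  | nil => exact hg
  | cons x u ih => exact graft_mem_derivedChain x hn ih

theorem finRotate_ne_one : finRotate (d + 2) ≠ 1 := fun h => by
  have := congrArg (fun π : Equiv.Perm (Fin (d + 2)) => π 0) h
  simp at this

theorem gen_zero_ne_one : gen d (0 : ZMod s) ≠ 1 := fun h =>
  finRotate_ne_one (by rw [← rootPerm_gen_zero (s := s), h, rootPerm_one])

/-- If `f` moves `u`, then `f` does not commute with its own copy below `u`, and from the first term
on the series contains such copies. The first term is nontrivial because a_0 does not commute with
a_1, its graft at the last letter; here `2 ≤ s` makes the index 1 differ from 0. -/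
theorem derivedChain_ne_bot (hs : 2 ≤ s) (n : ℕ) : (genGroup d s).derivedChain n ≠ ⊥ := by
  have h1 : (genGroup d s).derivedChain 1 ≠ ⊥ := by
    intro h
    have hs1 : (0 : ZMod s) + 1 ≠ 0 := by
      have : Fact (1 < s) := ⟨hs⟩
      rw [zero_add]
      exact one_ne_zero
    have hc : ⁅gen d (0 : ZMod s), gen d (0 + 1 : ZMod s)⁆ ∈ (genGroup d s).derivedChain 1 :=
      Subgroup.commutator_mem_commutator (gen_mem _) (gen_mem _)
    rw [h, Subgroup.mem_bot, commutatorElement_eq_one_iff_mul_comm, ← graft_last_gen hs1] at hc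
    refine gen_zero_ne_one (d := d) (s := s)
      (eq_one_of_commute_graftAt (u := [Fin.last (d + 1)]) ?_ hc)
    rw [apply_singleton_eq, rootPerm_gen_zero, finRotate_apply_eq, Fin.last_add_one]
    intro h
    exact (Fin.last_pos (n := d)).ne (List.singleton_injective h)
  induction n with
  | zero => exact fun h => h1 (le_bot_iff.1 (h ▸ Subgroup.derivedChain_antitone _ zero_le_one))
  | succ n ih =>
    rcases Nat.eq_zero_or_pos n with rfl | hn
    · exact h1
    obtain ⟨f, hf, hf1⟩ := (Subgroup.bot_or_exists_ne_one _).resolve_left ih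
    obtain ⟨u, hu⟩ := exists_apply_ne hf1
    intro h
    have hc : ⁅f, graftAt u f⁆ ∈ (genGroup d s).derivedChain (n + 1) :=
      Subgroup.commutator_mem_commutator hf (graftAt_mem_derivedChain u hn hf)
    rw [h, Subgroup.mem_bot, commutatorElement_eq_one_iff_mul_comm] at hc
    exact hf1 (eq_one_of_commute_graftAt hu hc)

/-- Two elements fixing level n act on level n + 1 through root permutations of their sections, and
these are commuting rotations. -/
theorem apply_eq_of_mem_derivedChain (n : ℕ) :
    ∀ {g}, g ∈ (genGroup d s).derivedChain n → ∀ u, u.length = n → g.1 u = u := by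
  induction n with
  | zero => intro g _ u hu; rw [List.length_eq_zero_iff.1 hu, apply_nil]
  | succ n ih =>
    intro g hg u hu
    have hmem : ∀ {f}, f ∈ (genGroup d s).derivedChain n → f ∈ genGroup d s :=
      fun hf => Subgroup.derivedChain_le _ n hf
    let St : Subgroup (TreeAut (d + 2)) :=
      { carrier := {f | f.1 u = u}
        one_mem' := rfl
        mul_mem' := fun {f g} (hf : f.1 u = u) (hg : g.1 u = u) => by
          change (f * g).1 u = u
          rw [mul_apply, hg, hf]
        inv_mem' := fun {f} (hf : f.1 u = u) => by
          change (f⁻¹).1 u = u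
          conv_lhs => rw [← hf, inv_apply_self] }
    suffices h : (genGroup d s).derivedChain (n + 1) ≤ St from h hg
    refine Subgroup.commutator_le.2 fun a ha b hb => ?_
    have hcomm : ∀ w : List (Fin (d + 2)), w.length = n + 1 → (a * b).1 w = (b * a).1 w := by
      intro w hw
      obtain ⟨v, x, rfl⟩ : ∃ v x, w = v ++ [x] :=
        ⟨_, _, (List.dropLast_append_getLast (by rintro rfl; simp at hw)).symm⟩
      have hv : v.length = n := by simpa using hw
      have := rootPerm_mul_comm (sectionAt_mem v (hmem ha)) (sectionAt_mem v (hmem hb))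
      rw [apply_append', apply_append', sectionAt_mul, sectionAt_mul, apply_singleton_eq,
        apply_singleton_eq, rootPerm_mul, rootPerm_mul, mul_apply, mul_apply, ih ha v hv,
        ih hb v hv, ih ha v hv, this]
    have hab : ⁅a, b⁆ * (b * a) = a * b := by rw [commutatorElement_def]; group
    have h := hcomm (((b * a)⁻¹).1 u) (by rw [length_apply, hu])
    rwa [apply_inv_self, ← hab, mul_apply, apply_inv_self] at h

/-- A series that stops would have a nontrivial term fixing every level. -/
theorem derivedChain_succ_ne (hs : 2 ≤ s) (n : ℕ) :
    (genGroup d s).derivedChain (n + 1) ≠ (genGroup d s).derivedChain n := by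
  intro h
  refine derivedChain_ne_bot (d := d) hs n ((Subgroup.eq_bot_iff_forall _).2 fun g hg => ?_)
  apply ext_apply
  intro u
  rw [← Subgroup.derivedChain_eq_of_succ_eq h u.length] at hg
  exact apply_eq_of_mem_derivedChain u.length
    (Subgroup.derivedChain_antitone _ (Nat.le_add_left _ _) hg) u rfl

theorem exists_mem_derivedChain_ne_one (hs : 2 ≤ s) (n : ℕ) :
    ∃ g ∈ (genGroup d s).derivedChain n, g ≠ 1 :=
  (Subgroup.bot_or_exists_ne_one _).resolve_left (derivedChain_ne_bot hs n)

/-- The elements of the group fixing the first level whose first-level sections lie in `K`. -/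
def levelSubgroup (s : ℕ) (K : Subgroup (TreeAut (d + 2))) : Subgroup (TreeAut (d + 2)) where
  carrier := {g | g ∈ genGroup d s ∧ rootPerm g = 1 ∧ ∀ x, sectionAt g [x] ∈ K}
  one_mem' := ⟨one_mem _, rootPerm_one, fun x => by rw [sectionAt_one]; exact one_mem _⟩
  mul_mem' := by
    rintro f g ⟨hf, hf1, hf2⟩ ⟨hg, hg1, hg2⟩
    refine ⟨mul_mem hf hg, by rw [rootPerm_mul, hf1, hg1, one_mul], fun x => ?_⟩
    rw [sectionAt_mul_letter]
    exact mul_mem (hf2 _) (hg2 _)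
  inv_mem' := by
    rintro f ⟨hf, hf1, hf2⟩
    refine ⟨inv_mem hf, by rw [rootPerm_inv, hf1, inv_one], fun x => ?_⟩
    rw [sectionAt_inv_letter]
    exact inv_mem (hf2 _)

theorem conj_mem_levelSubgroup {K : Subgroup (TreeAut (d + 2))}
    (hK : ∀ g ∈ genGroup d s, ∀ n ∈ K, g * n * g⁻¹ ∈ K) :
    ∀ g ∈ genGroup d s, ∀ n ∈ levelSubgroup s K, g * n * g⁻¹ ∈ levelSubgroup s K := by
  rintro g hg n ⟨hn, hn1, hn2⟩
  refine ⟨mul_mem (mul_mem hg hn) (inv_mem hg), ?_, fun x => ?_⟩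
  · rw [rootPerm_mul, rootPerm_mul, hn1, mul_one, rootPerm_inv, mul_inv_cancel]
  · rw [sectionAt_mul_letter, sectionAt_mul_letter, sectionAt_inv_letter, rootPerm_inv, hn1,
      Equiv.Perm.one_apply]
    exact hK _ (sectionAt_mem_letter hg _) _ (hn2 _)

/-- A prodense subgroup meets every coset of the subgroup of the elements fixing the first level
with sections in `K`, when `K` is normal and meets the commutator subgroup. -/
theorem _root_.Subgroup.ProdenseIn.exists_mem_levelSubgroup {H K : Subgroup (TreeAut (d + 2))}
    (hH : H.ProdenseIn (genGroup d s)) (hK : ∀ g ∈ genGroup d s, ∀ n ∈ K, g * n * g⁻¹ ∈ K)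
    (hK1 : ∃ k ∈ K, k ∈ (genGroup d s).derivedChain 1 ∧ k ≠ 1) {g : TreeAut (d + 2)}
    (hg : g ∈ genGroup d s) : ∃ h ∈ H, h⁻¹ * g ∈ levelSubgroup s K := by
  obtain ⟨k, hk, hkD, hk1⟩ := hK1
  refine hH.2 (levelSubgroup s K) (fun f hf => hf.1) (conj_mem_levelSubgroup hK) (fun h => ?_) g hg
  -- Branching places a copy of `k` below a letter inside G, which is why `k` is taken in the
  -- commutator subgroup.
  have hmem : graft 0 k ∈ levelSubgroup s K := by
    refine ⟨Subgroup.derivedChain_le _ 1 (graft_mem_commutator 0 hkD), rootPerm_graft _ _,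
      fun x => ?_⟩
    rw [sectionAt_graft]
    split_ifs
    · exact hk
    · exact one_mem _
  rw [h, Subgroup.mem_bot, ← map_one (graft 0)] at hmem
  exact hk1 (graft_injective 0 hmem)

theorem conj_mem_genDerivedChain (n : ℕ) : ∀ g ∈ genGroup d s,
    ∀ k ∈ (genGroup d s).derivedChain n, g * k * g⁻¹ ∈ (genGroup d s).derivedChain n :=
  fun _ hg _ hk => Subgroup.conj_mem_derivedChain n hg hk

/-- The version of `ProdenseIn.exists_mem_levelSubgroup` for the derived series. -/
theorem _root_.Subgroup.ProdenseIn.exists_mem_levelSubgroup_derivedChain (hs : 2 ≤ s)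
    {H : Subgroup (TreeAut (d + 2))} (hH : H.ProdenseIn (genGroup d s)) (n : ℕ)
    {g : TreeAut (d + 2)} (hg : g ∈ genGroup d s) :
    ∃ h ∈ H, h⁻¹ * g ∈ levelSubgroup s ((genGroup d s).derivedChain n) := by
  -- The index n + 1 puts `k` both in the n-th term and in the commutator subgroup, also when n = 0.
  obtain ⟨k, hk, hk1⟩ := exists_mem_derivedChain_ne_one (d := d) hs (n + 1)
  exact hH.exists_mem_levelSubgroup (conj_mem_genDerivedChain n)
    ⟨k, Subgroup.derivedChain_antitone _ (Nat.le_succ n) hk,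
      Subgroup.derivedChain_antitone _ (Nat.le_add_left 1 n) hk, hk1⟩ hg

/-- A nontrivial normal N meets G' nontrivially, by commutators with grafts, so the elements of G
fixing the first level with sections in N form a nontrivial normal subgroup. Approximating in `H`,
modulo this subgroup, a lift of `g` to the letter `x` gives the required section. -/
theorem _root_.Subgroup.ProdenseIn.secGroup_letter (hs : 2 ≤ s) {H : Subgroup (TreeAut (d + 2))}
    (hH : H.ProdenseIn (genGroup d s)) (x : Fin (d + 2)) :
    (secGroup H [x]).ProdenseIn (genGroup d s) := by
  refine ⟨secGroup_le hH.1 _, fun N hN hNn hN1 g hg => ?_⟩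
  have hK1 : ∃ k ∈ N, k ∈ (genGroup d s).derivedChain 1 ∧ k ≠ 1 := by
    obtain ⟨f, hf, hf1⟩ := (Subgroup.bot_or_exists_ne_one N).resolve_left hN1
    obtain ⟨u, hu⟩ := exists_apply_ne hf1
    obtain ⟨t, ht, ht1⟩ := exists_mem_derivedChain_ne_one (d := d) hs 1
    have htu := graftAt_mem_derivedChain u le_rfl ht
    have htG := Subgroup.derivedChain_le _ 1 htu
    refine ⟨⁅f, graftAt u t⁆, ?_, Subgroup.commutator_mem_commutator (hN hf) htG, fun h => ?_⟩
    · rw [commutatorElement_def, mul_assoc, mul_assoc, ← mul_assoc (graftAt u t)]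
      exact mul_mem hf (hNn _ htG _ (inv_mem hf))
    · rw [commutatorElement_eq_one_iff_mul_comm] at h
      exact ht1 (eq_one_of_commute_graftAt hu h)
  obtain ⟨f, hf, hfx, rfl⟩ := exists_section_eq hg x
  obtain ⟨h, hh, -, h2, h3⟩ := hH.exists_mem_levelSubgroup hNn hK1 hf
  have hperm : rootPerm h = rootPerm f := by
    rw [rootPerm_mul, rootPerm_inv, inv_mul_eq_one] at h2
    exact h2
  refine ⟨sectionAt h [x], mem_secGroup_letter.2 ⟨h, hh, by rw [hperm, hfx], rfl⟩, ?_⟩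
  have := h3 x
  rwa [sectionAt_mul_letter, sectionAt_inv_letter, hfx,
    show (rootPerm h)⁻¹ x = x by rw [Equiv.Perm.inv_eq_iff_eq, hperm, hfx]] at this

theorem _root_.Subgroup.ProdenseIn.exists_rootPerm_apply (hs : 2 ≤ s)
    {H : Subgroup (TreeAut (d + 2))} (hH : H.ProdenseIn (genGroup d s)) (x y : Fin (d + 2)) :
    ∃ h ∈ H, rootPerm h x = y := by
  obtain ⟨f, hf, hfx⟩ := exists_mem_rootPerm_apply (s := s) x y
  obtain ⟨h, hh, -, h2, -⟩ := hH.exists_mem_levelSubgroup_derivedChain hs 0 hf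
  rw [rootPerm_mul, rootPerm_inv, inv_mul_eq_one] at h2
  exact ⟨h, hh, by rw [h2, hfx]⟩

end Branch

/-! ### From a full section group back to the whole group. -/

section Lifting

set_option linter.unusedSectionVars false

open scoped commutatorElement

variable {d s : ℕ} [NeZero s]

/-- The elements of `H` fixing the first level. -/
def rootStab {m : ℕ} (H : Subgroup (TreeAut m)) : Subgroup (TreeAut m) where
  carrier := {h | h ∈ H ∧ rootPerm h = 1}
  one_mem' := ⟨one_mem _, rootPerm_one⟩
  mul_mem' := fun ⟨hf, hf1⟩ ⟨hg, hg1⟩ =>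
    ⟨mul_mem hf hg, by rw [rootPerm_mul, hf1, hg1, one_mul]⟩
  inv_mem' := fun ⟨hf, hf1⟩ => ⟨inv_mem hf, by rw [rootPerm_inv, hf1, inv_one]⟩

theorem rootPerm_of_mem_derivedChain {m : ℕ} {H : Subgroup (TreeAut m)} (n : ℕ) {h : TreeAut m}
    (hh : h ∈ (rootStab H).derivedChain n) : rootPerm h = 1 :=
  (Subgroup.derivedChain_le _ n hh).2

theorem sectionAt_commutator {m : ℕ} {f g : TreeAut m} (hf : rootPerm f = 1)
    (hg : rootPerm g = 1) (x : Fin m) :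
    sectionAt ⁅f, g⁆ [x] = ⁅sectionAt f [x], sectionAt g [x]⁆ := by
  simp [commutatorElement_def, sectionAt_mul_letter, sectionAt_inv_letter, rootPerm_inv, hf, hg]

/-- On the stabiliser of the first level, taking the section at a letter is a homomorphism into G.
-/
theorem sectionAt_mem_derivedChain {H : Subgroup (TreeAut (d + 2))} (hH : H ≤ genGroup d s)
    (n : ℕ) (y : Fin (d + 2)) : (rootStab H).derivedChain n ≤ rootStab H ∧
      ∀ h ∈ (rootStab H).derivedChain n, sectionAt h [y] ∈ (genGroup d s).derivedChain n := by
  refine ⟨Subgroup.derivedChain_le _ n, ?_⟩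
  suffices hS : secGroup ((rootStab H).derivedChain n) [y] ≤ (genGroup d s).derivedChain n from
    fun h hh => hS (mem_secGroup_letter.2
      ⟨h, hh, by rw [rootPerm_of_mem_derivedChain n hh, Equiv.Perm.one_apply], rfl⟩)
  induction n with
  | zero => exact secGroup_le (fun h (hh : h ∈ rootStab H) => hH hh.1) _
  | succ n ih =>
    rintro _ ⟨h, hh, -, rfl⟩
    let P : Subgroup (TreeAut (d + 2)) :=
      { carrier := {h | rootPerm h = 1 ∧ sectionAt h [y] ∈ (genGroup d s).derivedChain (n + 1)}
        one_mem' := ⟨rootPerm_one, by rw [sectionAt_one]; exact one_mem _⟩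
        mul_mem' := fun {f g} ⟨hf, hf1⟩ ⟨hg, hg1⟩ =>
          ⟨by rw [rootPerm_mul, hf, hg, one_mul], by
            rw [sectionAt_mul_letter, hg]; exact mul_mem hf1 hg1⟩
        inv_mem' := fun {f} ⟨hf, hf1⟩ =>
          ⟨by rw [rootPerm_inv, hf, inv_one], by
            rw [sectionAt_inv_letter, hf]; exact inv_mem hf1⟩ }
    have hP : (rootStab H).derivedChain (n + 1) ≤ P := by
      refine Subgroup.commutator_le.2 fun a ha b hb => ?_
      have ha1 := rootPerm_of_mem_derivedChain n ha
      have hb1 := rootPerm_of_mem_derivedChain n hb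
      refine ⟨?_, ?_⟩
      · simp [commutatorElement_def, rootPerm_mul, rootPerm_inv, ha1, hb1]
      · rw [sectionAt_commutator ha1 hb1]
        exact Subgroup.commutator_mem_commutator
          (ih (mem_secGroup_letter.2 ⟨a, ha, by rw [ha1, Equiv.Perm.one_apply], rfl⟩))
          (ih (mem_secGroup_letter.2 ⟨b, hb, by rw [hb1, Equiv.Perm.one_apply], rfl⟩))
    exact (hP hh).2

/-- When the section homomorphism from the first-level stabiliser of `H` is onto G, it maps each
derived term onto the corresponding one. -/
theorem exists_section_eq_of_mem_derivedChain {H : Subgroup (TreeAut (d + 2))}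
    (hH : H ≤ genGroup d s) {x : Fin (d + 2)} (hx : secGroup H [x] = genGroup d s) (n : ℕ) :
    (genGroup d s).derivedChain n ≤ secGroup ((rootStab H).derivedChain n) [x] := by
  induction n with
  | zero =>
    intro g hg
    rw [Subgroup.derivedChain, ← hx, mem_secGroup_letter] at hg
    obtain ⟨h, hh, hhx, rfl⟩ := hg
    exact mem_secGroup_letter.2 ⟨h, ⟨hh, rootPerm_eq_one_of_fixed (hH hh) hhx⟩, hhx, rfl⟩
  | succ n ih =>
    refine Subgroup.commutator_le.2 fun a ha b hb => ?_
    obtain ⟨f, hf, -, rfl⟩ := mem_secGroup_letter.1 (ih ha)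
    obtain ⟨g, hg, -, rfl⟩ := mem_secGroup_letter.1 (ih hb)
    have hfg : ⁅f, g⁆ ∈ (rootStab H).derivedChain (n + 1) :=
      Subgroup.commutator_mem_commutator hf hg
    refine mem_secGroup_letter.2 ⟨_, hfg, ?_, sectionAt_commutator
      (rootPerm_of_mem_derivedChain n hf) (rootPerm_of_mem_derivedChain n hg) x⟩
    rw [rootPerm_of_mem_derivedChain _ hfg, Equiv.Perm.one_apply]

theorem secGroup_letter_eq_of_prodenseIn (hs : 2 ≤ s) {H : Subgroup (TreeAut (d + 2))}
    (hH : H.ProdenseIn (genGroup d s)) {x : Fin (d + 2)} (hx : secGroup H [x] = genGroup d s)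
    (y : Fin (d + 2)) : secGroup H [y] = genGroup d s := by
  obtain ⟨h, hh, rfl⟩ := hH.exists_rootPerm_apply hs x y
  exact secGroup_letter_eq hH.1 hx hh

/-- Modulo a term of the derived series, elements of the commutator subgroup are sections at `x` of
elements of `H` with trivial section at a second letter `v`. -/
theorem exists_trivial_section (hs : 2 ≤ s) {H : Subgroup (TreeAut (d + 2))}
    (hH : H.ProdenseIn (genGroup d s)) {x : Fin (d + 2)} (hx : secGroup H [x] = genGroup d s)
    {v : Fin (d + 2)} (hv : v ≠ x) (n : ℕ) {g : TreeAut (d + 2)}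
    (hg : g ∈ (genGroup d s).derivedChain 1) :
    ∃ h ∈ rootStab H, sectionAt h [v] = 1 ∧
      (sectionAt h [x])⁻¹ * g ∈ (genGroup d s).derivedChain n := by
  obtain ⟨h, hh, -, h2, h3⟩ := hH.exists_mem_levelSubgroup_derivedChain hs n
    (Subgroup.derivedChain_le _ 1 (graft_mem_commutator x hg))
  have hh1 : rootPerm h = 1 := by
    rw [rootPerm_mul, rootPerm_inv, rootPerm_graft, mul_one, inv_eq_one] at h2
    exact h2
  have hsec : ∀ y, sectionAt (h⁻¹ * graft x g) [y] =
      (sectionAt h [y])⁻¹ * sectionAt (graft x g) [y] := fun y => by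
    rw [sectionAt_mul_letter, sectionAt_inv_letter, rootPerm_graft, hh1]
    rfl
  have hv1 : sectionAt h [v] ∈ (genGroup d s).derivedChain n := by
    have := h3 v
    rw [hsec, sectionAt_graft_of_ne hv, mul_one] at this
    simpa using this
  have hx1 := h3 x
  rw [hsec, sectionAt_graft_self] at hx1
  -- The element `h` approximates the graft of `g`, so its section at `v` is small but perhaps not
  -- trivial. It is cancelled by `k`, taken deep in the derived series of the stabiliser so that the
  -- section at `x` changes only within the n-th term.
  obtain ⟨k, hk, -, hkv⟩ := mem_secGroup_letter.1 (exists_section_eq_of_mem_derivedChain hH.1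
    (secGroup_letter_eq_of_prodenseIn hs hH hx v) n hv1)
  have hk1 := rootPerm_of_mem_derivedChain n hk
  have hkx := (sectionAt_mem_derivedChain hH.1 n x).2 k hk
  have hsec' : ∀ y, sectionAt (h * k⁻¹) [y] = sectionAt h [y] * (sectionAt k [y])⁻¹ := fun y => by
    rw [sectionAt_mul_letter, sectionAt_inv_letter, rootPerm_inv, hk1]
    rfl
  refine ⟨h * k⁻¹, mul_mem ⟨hh, hh1⟩ (inv_mem (Subgroup.derivedChain_le _ n hk)), ?_, ?_⟩
  · rw [hsec', hkv, mul_inv_cancel]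
  · rw [hsec', mul_inv_rev, inv_inv, mul_assoc]
    exact mul_mem hkx hx1

theorem mul_congr_derivedChain {n : ℕ} {a b a' b' : TreeAut (d + 2)} (hb : b ∈ genGroup d s)
    (ha' : a'⁻¹ * a ∈ (genGroup d s).derivedChain n)
    (hb' : b'⁻¹ * b ∈ (genGroup d s).derivedChain n) :
    (a' * b')⁻¹ * (a * b) ∈ (genGroup d s).derivedChain n := by
  have := mul_mem hb' (conj_mem_genDerivedChain n _ (inv_mem hb) _ ha')
  convert this using 1
  group

theorem inv_congr_derivedChain {n : ℕ} {a a' : TreeAut (d + 2)} (ha : a ∈ genGroup d s)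
    (ha' : a'⁻¹ * a ∈ (genGroup d s).derivedChain n) :
    a'⁻¹⁻¹ * a⁻¹ ∈ (genGroup d s).derivedChain n := by
  have := conj_mem_genDerivedChain n _ ha _ (inv_mem ha')
  convert this using 1
  group

/-- If `h` has trivial sections on `T` and `k` has trivial section at `v`, then `⁅h, k⁆` has trivial
sections on both. Each letter added costs one step of the derived series, while the precision `n` at
`x` stays free. -/
theorem exists_trivial_sections (hs : 2 ≤ s) {H : Subgroup (TreeAut (d + 2))}
    (hH : H.ProdenseIn (genGroup d s)) {x : Fin (d + 2)} (hx : secGroup H [x] = genGroup d s)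
    (n : ℕ) (T : Finset (Fin (d + 2))) : x ∉ T →
    ∀ g ∈ (genGroup d s).derivedChain (T.card + 1), ∃ h ∈ rootStab H,
      (∀ v ∈ T, sectionAt h [v] = 1) ∧
        (sectionAt h [x])⁻¹ * g ∈ (genGroup d s).derivedChain n := by
  induction T using Finset.induction_on with
  | empty =>
    intro _ g hg
    obtain ⟨h, hh, -, hhx⟩ := mem_secGroup_letter.1
      (exists_section_eq_of_mem_derivedChain hH.1 hx 0 (Subgroup.derivedChain_le _ _ hg))
    refine ⟨h, hh, by simp, ?_⟩
    rw [hhx, inv_mul_cancel]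
    exact one_mem _
  | insert v T hvT ih =>
    intro hxT
    rw [Finset.mem_insert, not_or] at hxT
    let P : Subgroup (TreeAut (d + 2)) :=
      { carrier := {g | g ∈ genGroup d s ∧ ∃ h ∈ rootStab H,
          (∀ w ∈ insert v T, sectionAt h [w] = 1) ∧
            (sectionAt h [x])⁻¹ * g ∈ (genGroup d s).derivedChain n}
        one_mem' := ⟨one_mem _, 1, one_mem _, fun w _ => sectionAt_one _, by
          rw [sectionAt_one, inv_one, one_mul]; exact one_mem _⟩
        mul_mem' := by
          rintro f g ⟨hf, h, hh, hh1, hh2⟩ ⟨hg, k, hk, hk1, hk2⟩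
          refine ⟨mul_mem hf hg, h * k, mul_mem hh hk, fun w hw => ?_, ?_⟩
          · rw [sectionAt_mul_letter, hk.2, Equiv.Perm.one_apply, hh1 w hw, hk1 w hw, one_mul]
          · rw [sectionAt_mul_letter, hk.2, Equiv.Perm.one_apply]
            exact mul_congr_derivedChain hg hh2 hk2
        inv_mem' := by
          rintro f ⟨hf, h, hh, hh1, hh2⟩
          have hsec : ∀ y, sectionAt h⁻¹ [y] = (sectionAt h [y])⁻¹ := fun y => by
            rw [sectionAt_inv_letter, hh.2]; rfl
          refine ⟨inv_mem hf, h⁻¹, inv_mem hh, fun w hw => ?_, ?_⟩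
          · rw [hsec, hh1 w hw, inv_one]
          · rw [hsec]
            exact inv_congr_derivedChain hf hh2 }
    have hle : (genGroup d s).derivedChain ((insert v T).card + 1) ≤ P := by
      rw [Finset.card_insert_of_notMem hvT]
      refine Subgroup.commutator_le.2 fun a ha b hb => ?_
      obtain ⟨h, hh, hh1, hh2⟩ := ih hxT.2 a ha
      obtain ⟨k, hk, hk1, hk2⟩ := exists_trivial_section hs hH hx (Ne.symm hxT.1) n
        (Subgroup.derivedChain_antitone _ (Nat.le_add_left 1 _) hb)
      have haG := Subgroup.derivedChain_le _ _ ha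
      have hbG := Subgroup.derivedChain_le _ _ hb
      refine ⟨?_, ⁅h, k⁆, ?_, fun w hw => ?_, ?_⟩
      · rw [commutatorElement_def]
        exact mul_mem (mul_mem (mul_mem haG hbG) (inv_mem haG)) (inv_mem hbG)
      · rw [commutatorElement_def]
        exact mul_mem (mul_mem (mul_mem hh hk) (inv_mem hh)) (inv_mem hk)
      · rw [sectionAt_commutator hh.2 hk.2]
        rcases Finset.mem_insert.1 hw with rfl | hw
        · rw [hk1, commutatorElement_one_right]
        · rw [hh1 w hw, commutatorElement_one_left]
      · rw [sectionAt_commutator hh.2 hk.2]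
        exact mul_congr_derivedChain (inv_mem hbG) (mul_congr_derivedChain (inv_mem haG)
          (mul_congr_derivedChain hbG hh2 hk2) (inv_congr_derivedChain haG hh2))
          (inv_congr_derivedChain hbG hk2)
    exact fun g hg => (hle hg).2

/-- All letters other than `x` are cleared, starting from a target in one derived term but not in
the next. With precision equal to that next term, a trivial section at `x` would put the target into
it. -/
theorem exists_graft_mem (hs : 2 ≤ s) {H : Subgroup (TreeAut (d + 2))}
    (hH : H.ProdenseIn (genGroup d s)) {x : Fin (d + 2)} (hx : secGroup H [x] = genGroup d s) :
    ∃ r, graft x r ∈ H ∧ r ≠ 1 := by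
  classical
  have hlt : ∃ g ∈ (genGroup d s).derivedChain ((Finset.univ.erase x).card + 1),
      g ∉ (genGroup d s).derivedChain ((Finset.univ.erase x).card + 1 + 1) := by
    by_contra! h
    exact derivedChain_succ_ne hs _
      (le_antisymm (Subgroup.derivedChain_antitone _ (Nat.le_succ _)) h)
  obtain ⟨g, hg, hg'⟩ := hlt
  obtain ⟨h, hh, hh1, hh2⟩ := exists_trivial_sections hs hH hx _ _ (Finset.notMem_erase x _) g hg
  have h3 := eq_graft hh.2 fun y hy => hh1 y (Finset.mem_erase.2 ⟨hy, Finset.mem_univ y⟩)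
  refine ⟨sectionAt h [x], h3 ▸ hh.1, fun h1 => hg' ?_⟩
  rwa [h1, inv_one, one_mul] at hh2

/-- A prodense subgroup with full section at a letter is the whole group. -/
theorem eq_of_secGroup_letter_eq (hs : 2 ≤ s) {H : Subgroup (TreeAut (d + 2))}
    (hH : H.ProdenseIn (genGroup d s)) {x : Fin (d + 2)} (hx : secGroup H [x] = genGroup d s) :
    H = genGroup d s := by
  -- Fullness at `x` supplies `k ∈ H` fixing `x` whose section cancels that of `h`, so conjugation
  -- by `h * k` moves the graft to `y` without altering `r`.
  have hmem : ∀ y r, graft x r ∈ H → graft y r ∈ H := by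
    intro y r hr
    obtain ⟨h, hh, rfl⟩ := hH.exists_rootPerm_apply hs x y
    have ht := inv_mem (sectionAt_mem_letter (hH.1 hh) x)
    rw [← hx] at ht
    obtain ⟨k, hk, hkx, hkt⟩ := mem_secGroup_letter.1 ht
    have := mul_mem (mul_mem (mul_mem hh hk) hr) (inv_mem (mul_mem hh hk))
    rw [conj_graft, rootPerm_mul, Equiv.Perm.mul_apply, hkx, sectionAt_mul_letter, hkx, hkt] at this
    simpa using this
  have hconj : ∀ g ∈ genGroup d s, ∀ y r, graft y r ∈ H → graft y (g * r * g⁻¹) ∈ H := by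
    intro g hg y r hr
    rw [← secGroup_letter_eq_of_prodenseIn hs hH hx y] at hg
    obtain ⟨k, hk, hkx, rfl⟩ := mem_secGroup_letter.1 hg
    have := mul_mem (mul_mem hk hr) (inv_mem hk)
    rwa [conj_graft, hkx] at this
  -- The labels `r` are stable under conjugation by G and do not depend on the letter; hence this
  -- subgroup of `H` is normalised by G.
  let N : Subgroup (TreeAut (d + 2)) :=
    Subgroup.closure {f | ∃ y r, graft x r ∈ H ∧ f = graft y r}
  have hN : N ≤ H := by
    refine (Subgroup.closure_le _).2 ?_
    rintro _ ⟨y, r, hr, rfl⟩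
    exact hmem y r hr
  have hNn : ∀ g ∈ genGroup d s, ∀ n ∈ N, g * n * g⁻¹ ∈ N := by
    intro g hg n hn
    suffices h : N ≤ N.comap (MulAut.conj g).toMonoidHom from h hn
    refine (Subgroup.closure_le _).2 ?_
    rintro _ ⟨y, r, hr, rfl⟩
    change g * graft y r * g⁻¹ ∈ N
    rw [conj_graft]
    exact Subgroup.subset_closure
      ⟨_, _, hconj _ (sectionAt_mem_letter hg y) x r hr, rfl⟩
  obtain ⟨r, hr, hr1⟩ := exists_graft_mem hs hH hx
  have hN1 : N ≠ ⊥ := by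
    intro h
    have : graft x r ∈ N := Subgroup.subset_closure ⟨x, r, hr, rfl⟩
    rw [h, Subgroup.mem_bot, ← map_one (graft x)] at this
    exact hr1 (graft_injective x this)
  refine le_antisymm hH.1 fun g hg => ?_
  obtain ⟨h, hh, hn⟩ := hH.2 N (hN.trans hH.1) hNn hN1 g hg
  simpa using mul_mem hh (hN hn)

/-- A prodense subgroup with full section at some vertex is the whole group. -/
theorem eq_of_secGroup_eq (hs : 2 ≤ s) (u : List (Fin (d + 2))) :
    ∀ {H : Subgroup (TreeAut (d + 2))}, H.ProdenseIn (genGroup d s) →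
      secGroup H u = genGroup d s → H = genGroup d s := by
  induction u with
  | nil => intro H _ h; rwa [secGroup_nil] at h
  | cons x u ih =>
    intro H hH h
    rw [secGroup_cons] at h
    exact eq_of_secGroup_letter_eq hs hH (ih (hH.secGroup_letter hs x) h)

end Lifting

/-! ### Words in the generators, their sections and exponent sums. -/

section Words

set_option linter.unusedSectionVars false

open scoped Fin.NatCast Fin.CommRing commutatorElement

variable {d s : ℕ} [NeZero s]

variable (d) in
/-- The generator `a_i`, for the letter `(i, true)`, or its inverse, for the letter `(i, false)`. -/
def evalLetter (l : ZMod s × Bool) : TreeAut (d + 2) :=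
  if l.2 then gen d l.1 else (gen d l.1)⁻¹

variable (d) in
/-- The group element represented by a word in the generators and their inverses. -/
def evalWord (w : List (ZMod s × Bool)) : TreeAut (d + 2) := (w.map (evalLetter d)).prod

@[simp] theorem evalWord_nil : evalWord d ([] : List (ZMod s × Bool)) = 1 := rfl

@[simp] theorem evalWord_cons (l : ZMod s × Bool) (w : List (ZMod s × Bool)) :
    evalWord d (l :: w) = evalLetter d l * evalWord d w := by simp [evalWord]

@[simp] theorem evalWord_append (v w : List (ZMod s × Bool)) :
    evalWord d (v ++ w) = evalWord d v * evalWord d w := by simp [evalWord]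

theorem evalLetter_mem (l : ZMod s × Bool) : evalLetter d l ∈ genGroup d s := by
  unfold evalLetter
  split_ifs
  · exact gen_mem _
  · exact inv_mem (gen_mem _)

theorem evalWord_mem (w : List (ZMod s × Bool)) : evalWord d w ∈ genGroup d s := by
  induction w with
  | nil => exact one_mem _
  | cons l w ih => rw [evalWord_cons]; exact mul_mem (evalLetter_mem l) ih

theorem evalLetter_mul_not (i : ZMod s) (b : Bool) :
    evalLetter d (i, b) * evalLetter d (i, !b) = 1 := by
  cases b <;> simp [evalLetter]

variable (d) in
/-- The only letter of the alphabet at which the section of a generator or inverse of a generator is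
not trivial. -/
def activeLetter (l : ZMod s × Bool) : Fin (d + 2) :=
  if l.2 then Fin.last (d + 1) else rootPerm (gen d l.1) (Fin.last (d + 1))

/-- The section of a letter at a vertex of the first level, as a word. -/
def secLetter (l : ZMod s × Bool) (z : Fin (d + 2)) : List (ZMod s × Bool) :=
  if z = activeLetter d l then [(l.1 - 1, l.2)] else []

theorem evalWord_secLetter (l : ZMod s × Bool) (z : Fin (d + 2)) :
    evalWord d (secLetter l z) = sectionAt (evalLetter d l) [z] := by
  obtain ⟨i, b⟩ := l
  cases b
  · simp only [secLetter, activeLetter, evalLetter, Bool.false_eq_true, if_false,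
      sectionAt_inv_letter, sectionAt_gen, Equiv.Perm.inv_eq_iff_eq]
    split_ifs <;> simp [evalLetter]
  · simp only [secLetter, activeLetter, evalLetter, if_true, sectionAt_gen]
    split_ifs <;> simp [evalLetter]

/-- The section of a word at a vertex of the first level, as a word. -/
def secWord : List (ZMod s × Bool) → Fin (d + 2) → List (ZMod s × Bool)
  | [], _ => []
  | l :: w, z => secLetter l (rootPerm (evalWord d w) z) ++ secWord w z

theorem evalWord_secWord (w : List (ZMod s × Bool)) (z : Fin (d + 2)) :
    evalWord d (secWord w z) = sectionAt (evalWord d w) [z] := by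
  induction w with
  | nil => simp [secWord]
  | cons l w ih =>
    rw [secWord, evalWord_append, ih, evalWord_secLetter, evalWord_cons, sectionAt_mul_letter]

theorem secWord_append (v w : List (ZMod s × Bool)) (z : Fin (d + 2)) :
    secWord (v ++ w) z = secWord v (rootPerm (evalWord d w) z) ++ secWord w z := by
  induction v with
  | nil => rfl
  | cons l v ih =>
    rw [List.cons_append, secWord, ih, secWord, evalWord_append, rootPerm_mul, List.append_assoc]
    rfl

/-- The word with all indices lowered by one. -/
def shiftWord (w : List (ZMod s × Bool)) : List (ZMod s × Bool) := w.map fun l => (l.1 - 1, l.2)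

theorem secLetter_sublist (l : ZMod s × Bool) (z : Fin (d + 2)) :
    (secLetter l z).Sublist [(l.1 - 1, l.2)] := by
  rw [secLetter]
  split_ifs
  · exact List.Sublist.refl _
  · exact List.nil_sublist _

theorem secWord_sublist (w : List (ZMod s × Bool)) (z : Fin (d + 2)) :
    (secWord w z).Sublist (shiftWord w) := by
  induction w with
  | nil => exact List.Sublist.refl _
  | cons l w ih => exact (secLetter_sublist l _).append ih

theorem length_secWord_le (w : List (ZMod s × Bool)) (z : Fin (d + 2)) :
    (secWord w z).length ≤ w.length := by
  have := (secWord_sublist w z).length_le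
  rwa [shiftWord, List.length_map] at this

/-- Each letter is active at exactly one first-level letter, and root permutations only reorder the
sum: the letters of `w` are distributed among its sections, with indices lowered by one. -/
theorem sum_count_secWord (w : List (ZMod s × Bool)) (i : ZMod s) (b : Bool) :
    ∑ z : Fin (d + 2), (secWord w z).count (i, b) = w.count (i + 1, b) := by
  induction w with
  | nil => simp [secWord]
  | cons l w ih =>
    simp only [secWord, List.count_append, Finset.sum_add_distrib, ih]
    rw [add_comm, List.count_cons, Equiv.sum_comp (rootPerm (evalWord d w))
      fun z => (secLetter l z).count (i, b)]
    congr 1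
    have h1 : ∀ z : Fin (d + 2), (secLetter l z).count (i, b) =
        if z = activeLetter d l then (if l == (i + 1, b) then 1 else 0) else 0 := by
      intro z
      rw [secLetter]
      split_ifs with h2 h3
      · obtain rfl := eq_of_beq h3
        simp
      · refine List.count_eq_zero.2 fun h => h3 ?_
        have := List.mem_singleton.1 h
        rw [Prod.mk.injEq] at this
        exact beq_iff_eq.2 (Prod.ext (by rw [this.1]; ring) this.2.symm)
      · simp
    simp only [h1, Finset.sum_ite_eq', Finset.mem_univ, if_true]

/-- The exponent sum of the generator `a_i` in a word. -/
def expSum (w : List (ZMod s × Bool)) (i : ZMod s) : ℤ := w.count (i, true) - w.count (i, false)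

@[simp] theorem expSum_nil (i : ZMod s) : expSum ([] : List (ZMod s × Bool)) i = 0 := by
  simp [expSum]

theorem expSum_append (v w : List (ZMod s × Bool)) (i : ZMod s) :
    expSum (v ++ w) i = expSum v i + expSum w i := by
  simp only [expSum, List.count_append]; push_cast; ring

theorem expSum_singleton (j : ZMod s) (b : Bool) (i : ZMod s) :
    expSum [(j, b)] i = if j = i then (if b then 1 else -1) else 0 := by
  simp only [expSum, List.count_singleton, beq_iff_eq, Prod.mk.injEq]
  cases b <;> by_cases h : j = i <;> simp [h]

theorem sum_expSum_secWord (w : List (ZMod s × Bool)) (i : ZMod s) :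
    ∑ z : Fin (d + 2), expSum (secWord w z) i = expSum w (i + 1) := by
  simp only [expSum, Finset.sum_sub_distrib, ← sum_count_secWord (d := d) w i]
  push_cast
  ring

/-- The formal inverse of a word. -/
def invWord (w : List (ZMod s × Bool)) : List (ZMod s × Bool) :=
  (w.map fun l => (l.1, !l.2)).reverse

theorem evalWord_invWord (w : List (ZMod s × Bool)) :
    evalWord d (invWord w) = (evalWord d w)⁻¹ := by
  induction w with
  | nil => simp [invWord]
  | cons l w ih =>
    obtain ⟨i, b⟩ := l
    have h1 : invWord ((i, b) :: w) = invWord w ++ [(i, !b)] := by simp [invWord]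
    rw [h1, evalWord_append, ih, evalWord_cons (i, b), mul_inv_rev,
      inv_eq_of_mul_eq_one_right (evalLetter_mul_not i b)]
    simp

theorem expSum_invWord (w : List (ZMod s × Bool)) (i : ZMod s) :
    expSum (invWord w) i = - expSum w i := by
  induction w with
  | nil => simp [invWord]
  | cons l w ih =>
    obtain ⟨j, b⟩ := l
    have h1 : invWord ((j, b) :: w) = invWord w ++ [(j, !b)] := by simp [invWord]
    rw [h1, expSum_append, ih, ← List.singleton_append (x := (j, b)), expSum_append,
      expSum_singleton, expSum_singleton]
    cases b <;> by_cases h : j = i <;> simp [h]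

theorem exists_evalWord_eq {g : TreeAut (d + 2)} (hg : g ∈ genGroup d s) :
    ∃ w : List (ZMod s × Bool), evalWord d w = g := by
  induction hg using Subgroup.closure_induction with
  | mem g hg => obtain ⟨i, rfl⟩ := hg; exact ⟨[(i, true)], by simp [evalLetter]⟩
  | one => exact ⟨[], rfl⟩
  | mul f g _ _ hf hg =>
    obtain ⟨v, rfl⟩ := hf
    obtain ⟨w, rfl⟩ := hg
    exact ⟨v ++ w, evalWord_append v w⟩
  | inv g _ hg => obtain ⟨w, rfl⟩ := hg; exact ⟨invWord w, evalWord_invWord w⟩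

/-- Exponent sums are carried by words and are never claimed to be invariants of the group elements,
so the abelianisation of G need not be computed. -/
theorem exists_evalWord_eq_of_mem_commutator {g : TreeAut (d + 2)}
    (hg : g ∈ (genGroup d s).derivedChain 1) :
    ∃ w : List (ZMod s × Bool), evalWord d w = g ∧ ∀ i, expSum w i = 0 := by
  let P : Subgroup (TreeAut (d + 2)) :=
    { carrier := {g | ∃ w : List (ZMod s × Bool), evalWord d w = g ∧ ∀ i, expSum w i = 0}
      one_mem' := ⟨[], rfl, fun i => expSum_nil i⟩
      mul_mem' := by
        rintro _ _ ⟨v, rfl, hv⟩ ⟨w, rfl, hw⟩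
        exact ⟨v ++ w, evalWord_append v w, fun i => by rw [expSum_append, hv, hw, add_zero]⟩
      inv_mem' := by
        rintro _ ⟨w, rfl, hw⟩
        exact ⟨invWord w, evalWord_invWord w, fun i => by rw [expSum_invWord, hw, neg_zero]⟩ }
  have hP : (genGroup d s).derivedChain 1 ≤ P := by
    refine Subgroup.commutator_le.2 fun a ha b hb => ?_
    obtain ⟨v, rfl⟩ := exists_evalWord_eq ha
    obtain ⟨w, rfl⟩ := exists_evalWord_eq hb
    refine ⟨v ++ w ++ invWord v ++ invWord w, ?_, fun i => ?_⟩
    · simp [evalWord_invWord, commutatorElement_def, mul_assoc]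
    · simp only [expSum_append, expSum_invWord]
      ring
  exact hP hg

/-- A prodense subgroup contains an element represented by a word with the same exponent sums as a
given word. -/
theorem _root_.Subgroup.ProdenseIn.exists_evalWord_mem (hs : 2 ≤ s)
    {H : Subgroup (TreeAut (d + 2))} (hH : H.ProdenseIn (genGroup d s))
    (w : List (ZMod s × Bool)) :
    ∃ v : List (ZMod s × Bool), evalWord d v ∈ H ∧ ∀ i, expSum v i = expSum w i := by
  obtain ⟨h, hh, hn⟩ := hH.2 ((genGroup d s).derivedChain 1) (Subgroup.derivedChain_le _ 1)
    (conj_mem_genDerivedChain 1) (derivedChain_ne_bot hs 1) (evalWord d w) (evalWord_mem w)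
  obtain ⟨z, hz, hz0⟩ := exists_evalWord_eq_of_mem_commutator hn
  -- The word `z` represents `h⁻¹ * evalWord d w`, so this word represents `h`.
  refine ⟨w ++ invWord z, ?_, fun i => by rw [expSum_append, expSum_invWord, hz0]; simp⟩
  rw [evalWord_append, evalWord_invWord, hz]
  simpa using hh

theorem rootPerm_evalWord (w : List (ZMod s × Bool)) :
    rootPerm (evalWord d w) = finRotate (d + 2) ^ expSum w 0 := by
  induction w with
  | nil => simp
  | cons l w ih =>
    obtain ⟨j, b⟩ := l
    rw [← List.singleton_append, expSum_append, expSum_singleton, zpow_add, evalWord_append,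
      rootPerm_mul, ih]
    congr 1
    by_cases h : j = 0 <;> cases b <;> simp [evalLetter, rootPerm_gen, rootPerm_inv, h]

theorem rootPerm_evalLetter_of_ne {l : ZMod s × Bool} (h : l.1 ≠ 0) :
    rootPerm (evalLetter d l) = 1 := by
  rw [evalLetter]
  split_ifs
  · exact rootPerm_gen_of_ne h
  · rw [rootPerm_inv, rootPerm_gen_of_ne h, inv_one]

theorem activeLetter_of_ne {l : ZMod s × Bool} (h : l.1 ≠ 0) :
    activeLetter d l = Fin.last (d + 1) := by
  rw [activeLetter, rootPerm_gen_of_ne h]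
  simp

theorem activeLetter_true (i : ZMod s) : activeLetter d (i, true) = Fin.last (d + 1) := rfl

theorem activeLetter_zero_false : activeLetter d ((0 : ZMod s), false) = 0 := by
  simp [activeLetter, rootPerm_gen_zero]

theorem evalWord_cancel (v w : List (ZMod s × Bool)) (i : ZMod s) (b : Bool) :
    evalWord d (v ++ (i, b) :: (i, !b) :: w) = evalWord d (v ++ w) := by
  rw [evalWord_append, evalWord_cons, evalWord_cons, ← mul_assoc (evalLetter d (i, b)),
    evalLetter_mul_not, one_mul, evalWord_append]

theorem expSum_cancel (v w : List (ZMod s × Bool)) (i j : ZMod s) (b : Bool) :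
    expSum (v ++ (i, b) :: (i, !b) :: w) j = expSum (v ++ w) j := by
  rw [expSum_append, ← List.singleton_append (l := _ :: _), expSum_append,
    ← List.singleton_append (l := w), expSum_append, expSum_append, expSum_singleton,
    expSum_singleton]
  cases b <;> by_cases h : i = j <;> simp [h]

end Words

/-! ### A product of all generators in a section group, by minimal length. -/

section CyclicWord

set_option linter.unusedSectionVars false

open scoped Fin.NatCast Fin.CommRing

variable {d s : ℕ} [NeZero s]

variable (d) in
/-- If `w` acts on the first level as the `(d + 2)`-cycle, this is a word for the section at `0` of
its `k`-th power. -/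
def cycWord (w : List (ZMod s × Bool)) : ℕ → List (ZMod s × Bool)
  | 0 => []
  | k + 1 => secWord w ((k : ℕ) : Fin (d + 2)) ++ cycWord w k

theorem evalWord_cycWord {w : List (ZMod s × Bool)}
    (hw : rootPerm (evalWord d w) = finRotate (d + 2)) (k : ℕ) :
    evalWord d (cycWord d w k) = sectionAt (evalWord d w ^ k) [0] := by
  induction k with
  | zero => simp [cycWord]
  | succ k ih =>
    rw [cycWord, evalWord_append, ih, evalWord_secWord, sectionAt_pow_succ, hw,
      finRotate_pow_apply, zero_add]

theorem count_shiftWord (w : List (ZMod s × Bool)) (i : ZMod s) (b : Bool) :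
    (shiftWord w).count (i, b) = w.count (i + 1, b) := by
  have h2 := List.count_map_of_injective w (fun l : ZMod s × Bool => (l.1 - 1, l.2))
    (fun l l' h => by
      rw [Prod.mk.injEq, sub_left_inj] at h
      exact Prod.ext h.1 h.2) (i + 1, b)
  rw [add_sub_cancel_right] at h2
  rw [shiftWord, h2]

/-- The m-th power visits each letter once, so the sections concatenated here are all the
first-level sections of `w`, and together they use each letter of `w` once. -/
theorem cycWord_perm (w : List (ZMod s × Bool)) :
    (cycWord d w (d + 2)).Perm (shiftWord w) := by
  rw [List.perm_iff_count]
  rintro ⟨i, b⟩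
  have h1 : ∀ k, (cycWord d w k).count (i, b) =
      ∑ j ∈ Finset.range k, (secWord w ((j : ℕ) : Fin (d + 2))).count (i, b) := by
    intro k
    induction k with
    | zero => simp [cycWord]
    | succ k ih => rw [cycWord, List.count_append, ih, Finset.sum_range_succ, add_comm]
  rw [h1, count_shiftWord, ← sum_count_secWord (d := d), Finset.sum_range]
  simp only [Fin.cast_val_eq_self]

theorem length_cycWord (w : List (ZMod s × Bool)) :
    (cycWord d w (d + 2)).length = w.length := by
  rw [(cycWord_perm w).length_eq, shiftWord, List.length_map]

theorem secWord_infix_cycWord (w : List (ZMod s × Bool)) (z : Fin (d + 2)) :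
    secWord w z <:+: cycWord d w (d + 2) := by
  have h : ∀ k, z.val < k → secWord w z <:+: cycWord d w k := by
    intro k
    induction k with
    | zero => intro h; exact absurd h (Nat.not_lt_zero _)
    | succ k ih =>
      intro h
      rw [cycWord]
      rcases Nat.lt_succ_iff_lt_or_eq.1 h with h | rfl
      · exact (ih h).trans (List.suffix_append _ _).isInfix
      · rw [Fin.cast_val_eq_self]
        exact (List.prefix_append _ _).isInfix
  exact h _ z.2

/-- A word occurs in `H` if all its exponent sums are one, and a conjugate of the element it
represents is a section at some vertex of an element of `H` fixing this vertex. -/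
def Occurs (H : Subgroup (TreeAut (d + 2))) (w : List (ZMod s × Bool)) : Prop :=
  (∀ i, expSum w i = 1) ∧ ∃ u, ∃ g ∈ genGroup d s, g * evalWord d w * g⁻¹ ∈ secGroup H u

theorem Occurs.rotate {H : Subgroup (TreeAut (d + 2))} {v w : List (ZMod s × Bool)}
    (h : Occurs H (v ++ w)) : Occurs H (w ++ v) := by
  obtain ⟨h1, u, g, hg, hu⟩ := h
  refine ⟨fun i => by rw [expSum_append, add_comm, ← expSum_append, h1], u, g * evalWord d v,
    mul_mem hg (evalWord_mem v), ?_⟩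
  convert hu using 1
  simp only [evalWord_append]
  group

theorem Occurs.congr {H : Subgroup (TreeAut (d + 2))} {v w : List (ZMod s × Bool)}
    (h : Occurs H v) (hev : evalWord d v = evalWord d w) (hex : ∀ i, expSum v i = expSum w i) :
    Occurs H w :=
  ⟨fun i => by rw [← hex, h.1], hev ▸ h.2⟩

/-- Exponent sum 1 of a_0 makes `w` act as the m-cycle, so its m-th power fixes the first level. The
section of this power at 0 occurs one level deeper, conjugated by the section of `g`. -/
theorem Occurs.cycWord {H : Subgroup (TreeAut (d + 2))} {w : List (ZMod s × Bool)}
    (h : Occurs H w) : Occurs H (cycWord d w (d + 2)) := by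
  obtain ⟨h1, u, g, hg, hu⟩ := h
  have hrot : rootPerm (evalWord d w) = finRotate (d + 2) := by
    rw [rootPerm_evalWord, h1, zpow_one]
  refine ⟨fun i => ?_, u ++ [rootPerm g 0], sectionAt g [0], sectionAt_mem_letter hg 0, ?_⟩
  · rw [expSum, (cycWord_perm w).count_eq, (cycWord_perm w).count_eq, count_shiftWord,
      count_shiftWord]
    exact h1 (i + 1)
  · rw [secGroup_append, evalWord_cycWord hrot]
    have hk := pow_mem hu (d + 2)
    rw [conj_pow] at hk
    have hp : rootPerm (evalWord d w ^ (d + 2)) = 1 := by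
      ext1 x
      rw [rootPerm_pow, hrot, finRotate_pow_apply]
      simp
    refine mem_secGroup_letter.2 ⟨_, hk, ?_, ?_⟩
    · simp [rootPerm_mul, rootPerm_inv, hp]
    · simp [sectionAt_mul_letter, sectionAt_inv_letter, rootPerm_inv, hp]

theorem secWord_eq_nil (v : List (ZMod s × Bool)) (hv : ∀ l ∈ v, l.1 ≠ 0) {z : Fin (d + 2)}
    (hz : z ≠ Fin.last (d + 1)) : secWord v z = [] ∧ rootPerm (evalWord d v) z = z := by
  induction v with
  | nil => simp [secWord]
  | cons l v ih =>
    have hl : l.1 ≠ 0 := hv l (by simp)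
    obtain ⟨h1, h2⟩ := ih fun l hl => hv l (by simp [hl])
    refine ⟨?_, ?_⟩
    · rw [secWord, h1, h2, secLetter, activeLetter_of_ne hl, if_neg hz]
      rfl
    · rw [evalWord_cons, rootPerm_mul, Equiv.Perm.mul_apply, h2, rootPerm_evalLetter_of_ne hl,
        Equiv.Perm.one_apply]

theorem zero_ne_last : (0 : Fin (d + 2)) ≠ Fin.last (d + 1) := (Fin.last_pos (n := d)).ne

/-- Take `z` reaching the last letter after `D`. There a_0 is active and moves to 0; all of `v` is
inactive at 0 and fixes it; and 0 is where a_0⁻¹ is active. The section therefore has its two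
letters side by side. -/
theorem exists_cancel_secWord (C v D : List (ZMod s × Bool)) (hv : ∀ l ∈ v, l.1 ≠ 0) :
    ∃ z : Fin (d + 2), [((0 : ZMod s) - 1, false), ((0 : ZMod s) - 1, true)] <:+:
      secWord (C ++ (0, false) :: (v ++ (0, true) :: D)) z := by
  obtain ⟨z, hz⟩ := (rootPerm (evalWord d D)).surjective (Fin.last (d + 1))
  refine ⟨z, ?_⟩
  have h0 : rootPerm (evalLetter d ((0 : ZMod s), true)) (Fin.last (d + 1)) = 0 := by
    simp [evalLetter, rootPerm_gen_zero]
  obtain ⟨h1, h2⟩ := secWord_eq_nil v hv (zero_ne_last (d := d))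
  rw [secWord_append, secWord, secWord_append, secWord]
  simp only [evalWord_append, evalWord_cons, rootPerm_mul, Equiv.Perm.mul_apply,
    hz, h0, h1, h2, secLetter, activeLetter_true, activeLetter_zero_false,
    if_true]
  exact ⟨_, _, by simp only [List.append_assoc, List.nil_append]; rfl⟩

/-- Among the letters of index 0, take an inverse one directly followed, in this subsequence, by a
positive one. -/
theorem exists_split_of_mem {w : List (ZMod s × Bool)} (ht : ((0 : ZMod s), true) ∈ w) :
    ∃ C v D, (0, false) :: w = C ++ (0, false) :: (v ++ (0, true) :: D) ∧
      ∀ l ∈ v, l.1 ≠ 0 := by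
  induction w with
  | nil => simp at ht
  | cons l w ih =>
    obtain ⟨i, b⟩ := l
    by_cases hi : i = 0
    · subst hi
      cases b
      · obtain ⟨C, v, D, h, hv⟩ := ih (by simpa using ht)
        exact ⟨(0, false) :: C, v, D, by rw [h]; rfl, hv⟩
      · exact ⟨[], [], w, rfl, by simp⟩
    · have hw : ((0 : ZMod s), true) ∈ w := by
        rcases List.mem_cons.1 ht with h | h
        · exact absurd (congrArg Prod.fst h).symm hi
        · exact h
      obtain ⟨C, v, D, h, hv⟩ := ih hw
      cases C with
      | nil =>
        rw [List.nil_append, List.cons.injEq] at h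
        refine ⟨[], (i, b) :: v, D, by rw [h.2]; rfl, fun l hl => ?_⟩
        rcases List.mem_cons.1 hl with rfl | hl
        · exact hi
        · exact hv l hl
      | cons a C =>
        rw [List.cons_append, List.cons.injEq] at h
        exact ⟨(0, false) :: (i, b) :: C, v, D, by rw [h.2]; rfl, hv⟩

/-- Some product of all the generators `a_i`, in some order, occurs in every prodense subgroup. -/
theorem _root_.Subgroup.ProdenseIn.exists_occurs (hs : 2 ≤ s) {H : Subgroup (TreeAut (d + 2))}
    (hH : H.ProdenseIn (genGroup d s)) :
    ∃ w : List (ZMod s × Bool), Occurs H w ∧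
      ∀ i, w.count (i, false) = 0 ∧ w.count (i, true) = 1 := by
  classical
  have hex : ∃ n, ∃ w : List (ZMod s × Bool), Occurs H w ∧ w.length = n := by
    have hone : ∀ i, expSum ((Finset.univ : Finset (ZMod s)).toList.map fun i => (i, true)) i
        = 1 := by
      intro i
      have h1 := List.count_map_of_injective (Finset.univ : Finset (ZMod s)).toList
        (fun i => (i, true)) (Prod.mk_left_injective true) i
      have h2 : ((Finset.univ : Finset (ZMod s)).toList.map fun i => (i, true)).count (i, false)
          = 0 := List.count_eq_zero.2 (by simp)
      rw [expSum, h1, h2, List.count_eq_one_of_mem (Finset.nodup_toList _) (by simp)]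
      rfl
    obtain ⟨w, hw, hw1⟩ := hH.exists_evalWord_mem hs
      ((Finset.univ : Finset (ZMod s)).toList.map fun i => (i, true))
    exact ⟨_, w, ⟨fun i => by rw [hw1, hone], [], 1, one_mem _, by simpa using hw⟩, rfl⟩
  obtain ⟨w, hw, hwl⟩ := Nat.find_spec hex
  have hmin : ∀ v : List (ZMod s × Bool), Occurs H v → Nat.find hex ≤ v.length :=
    fun v hv => Nat.find_min' hex ⟨v, hv, rfl⟩
  -- A word of minimal length with a letter a_0⁻¹ can be rotated to begin with it. Exponent sum 1
  -- forces some a_0 as well, so the section word, which has the same length, contains a cancelling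
  -- pair, contradicting minimality.
  have hzero : ∀ v : List (ZMod s × Bool), Occurs H v → v.length = Nat.find hex →
      ((0 : ZMod s), false) ∉ v := by
    intro v hv hvl hmem
    obtain ⟨A, B, rfl⟩ := List.append_of_mem hmem
    have hrot := hv.rotate
    rw [List.cons_append] at hrot
    have ht : ((0 : ZMod s), true) ∈ B ++ A := by
      have h1 := hrot.1 0
      have h2 : 0 < ((0, false) :: (B ++ A)).count ((0 : ZMod s), true) := by
        rw [expSum] at h1
        omega
      simpa using List.count_pos_iff.1 h2
    obtain ⟨C, v, D, h, hv⟩ := exists_split_of_mem ht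
    obtain ⟨z, hz⟩ := exists_cancel_secWord (d := d) C v D hv
    have hinf := hz.trans (secWord_infix_cycWord _ z)
    rw [← h] at hinf
    obtain ⟨X, Y, hXY⟩ := hinf
    have hXY' : X ++ (0 - 1, false) :: (0 - 1, !false) :: Y =
        cycWord d ((0, false) :: (B ++ A)) (d + 2) := by
      rw [← hXY]; simp
    have hshort : Occurs H (X ++ Y) := hrot.cycWord.congr
      (by rw [← hXY', evalWord_cancel]) (fun i => by rw [← hXY', expSum_cancel])
    have hlen := congrArg List.length hXY'
    rw [length_cycWord] at hlen
    have := hmin _ hshort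
    simp only [List.length_append, List.length_cons] at hlen this hvl
    omega
  -- Passing to the section word keeps the length minimal and lowers indices by one, so every index
  -- is brought to 0.
  have hall : ∀ (n : ℕ) (v : List (ZMod s × Bool)), Occurs H v → v.length = Nat.find hex →
      v.count ((n : ZMod s), false) = 0 := by
    intro n
    induction n with
    | zero =>
      intro v hv hvl
      rw [Nat.cast_zero]
      exact List.count_eq_zero.2 (hzero v hv hvl)
    | succ n ih =>
      intro v hv hvl
      have := ih _ hv.cycWord (by rw [length_cycWord, hvl])
      rwa [(cycWord_perm v).count_eq, count_shiftWord, ← Nat.cast_succ] at this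
  refine ⟨w, hw, fun i => ?_⟩
  have h0 := hall i.val w hw hwl
  rw [ZMod.natCast_zmod_val] at h0
  refine ⟨h0, ?_⟩
  have := hw.1 i
  rw [expSum, h0] at this
  omega

end CyclicWord

/-! ### Sums over a level of the tree. -/

section LevelSum

variable {m : ℕ} {A : Type*} [AddCommMonoid A]

/-- The sum of a function over the words of length `n`. -/
def levelSum : ℕ → (List (Fin m) → A) → A
  | 0, φ => φ []
  | n + 1, φ => ∑ x, levelSum n fun u => φ (x :: u)

theorem levelSum_congr {n : ℕ} : ∀ {φ ψ : List (Fin m) → A},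
    (∀ u, u.length = n → φ u = ψ u) → levelSum n φ = levelSum n ψ := by
  induction n with
  | zero => intro φ ψ h; exact h [] rfl
  | succ n ih =>
    intro φ ψ h
    exact Finset.sum_congr rfl fun x _ => ih fun u hu => h _ (by simp [hu])

theorem levelSum_comp (n : ℕ) : ∀ (φ : List (Fin m) → A) (f : TreeAut m),
    levelSum n (fun u => φ (f.1 u)) = levelSum n φ := by
  induction n with
  | zero => intro φ f; simp [levelSum]
  | succ n ih =>
    intro φ f
    simp only [levelSum, apply_cons]
    rw [← Equiv.sum_comp (rootPerm f) fun x => levelSum n fun u => φ (x :: u)]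
    exact Finset.sum_congr rfl fun x _ =>
      ih (fun u => φ (rootPerm f x :: u)) (sectionAt f [x])

theorem levelSum_sum {ι : Type*} (T : Finset ι) (n : ℕ) : ∀ φ : ι → List (Fin m) → A,
    levelSum n (fun u => ∑ i ∈ T, φ i u) = ∑ i ∈ T, levelSum n (φ i) := by
  induction n with
  | zero => intro φ; rfl
  | succ n ih =>
    intro φ
    simp only [levelSum, ih]
    exact Finset.sum_comm

theorem levelSum_mul_left (c : ℤ) (n : ℕ) : ∀ φ : List (Fin m) → ℤ,
    levelSum n (fun u => c * φ u) = c * levelSum n φ := by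
  induction n with
  | zero => intro φ; rfl
  | succ n ih =>
    intro φ
    simp only [levelSum, ih, Finset.mul_sum]

theorem levelSum_sub (n : ℕ) : ∀ φ ψ : List (Fin m) → ℤ,
    levelSum n (fun u => φ u - ψ u) = levelSum n φ - levelSum n ψ := by
  induction n with
  | zero => intro φ ψ; rfl
  | succ n ih =>
    intro φ ψ
    simp only [levelSum, ih, Finset.sum_sub_distrib]

end LevelSum

/-! ### Contraction to the nucleus 1, a_i, a_i⁻¹, a_i a_j⁻¹, with exponent sums tracked. -/

section Contraction

set_option linter.unusedSectionVars false

variable {d s : ℕ} [NeZero s]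

/-- The words representing the elements of the nucleus. -/
def NucleusWord (w : List (ZMod s × Bool)) : Prop :=
  w = [] ∨ (∃ l, w = [l]) ∨ ∃ i j, i ≠ j ∧ w = [(i, true), (j, false)]

theorem NucleusWord.shiftWord {w : List (ZMod s × Bool)} (h : NucleusWord w) :
    NucleusWord (shiftWord w) := by
  rcases h with rfl | ⟨l, rfl⟩ | ⟨i, j, hij, rfl⟩
  · exact Or.inl rfl
  · exact Or.inr (Or.inl ⟨_, rfl⟩)
  · exact Or.inr (Or.inr ⟨i - 1, j - 1, fun h => hij (sub_left_injective h), rfl⟩)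

theorem NucleusWord.sublist {v w : List (ZMod s × Bool)} (h : NucleusWord w)
    (hvw : v.Sublist w) : NucleusWord v := by
  rcases Nat.lt_or_ge v.length 2 with hv | hv
  · match v, hv with
    | [], _ => exact Or.inl rfl
    | [l], _ => exact Or.inr (Or.inl ⟨l, rfl⟩)
  · have hw : w.length ≤ 2 := by
      rcases h with rfl | ⟨l, rfl⟩ | ⟨i, j, -, rfl⟩ <;> simp
    rwa [hvw.eq_of_length_le (hw.trans hv)]

variable (d) in
/-- The sections of `w` at the words of length `n` are represented by words of the nucleus, in a way
compatible with exponent sums. -/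
def NucleusSections (n : ℕ) (w : List (ZMod s × Bool)) : Prop :=
  ∃ W : List (Fin (d + 2)) → List (ZMod s × Bool),
    (∀ u, u.length = n → evalWord d (W u) = sectionAt (evalWord d w) u ∧ NucleusWord (W u)) ∧
      ∀ c, levelSum n (fun u => expSum (W u) c) = expSum w (c + n)

theorem NucleusSections.succ {n : ℕ} {w : List (ZMod s × Bool)}
    (h : ∀ x : Fin (d + 2), NucleusSections d n (secWord w x)) : NucleusSections d (n + 1) w := by
  choose W hW hWe using h
  refine ⟨fun u => match u with
    | [] => []
    | x :: u => W x u, fun u hu => ?_, fun c => ?_⟩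
  · match u, hu with
    | x :: u, hu =>
      have := hW x u (by simpa using hu)
      rwa [evalWord_secWord, ← sectionAt_cons] at this
  · simp only [levelSum, hWe, sum_expSum_secWord]
    push_cast
    rw [add_assoc]

theorem NucleusSections.congr {n : ℕ} {v w : List (ZMod s × Bool)} (h : NucleusSections d n v)
    (hev : evalWord d v = evalWord d w) (hex : ∀ i, expSum v i = expSum w i) :
    NucleusSections d n w := by
  obtain ⟨W, hW, hWe⟩ := h
  exact ⟨W, by rwa [← hev], fun c => by rw [hWe, hex]⟩

theorem NucleusWord.nucleusSections (n : ℕ) : ∀ {w : List (ZMod s × Bool)}, NucleusWord w →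
    NucleusSections d n w := by
  induction n with
  | zero =>
    intro w hw
    refine ⟨fun _ => w, fun u hu => ?_, fun c => by simp [levelSum]⟩
    rw [List.length_eq_zero_iff.1 hu, sectionAt_nil]
    exact ⟨rfl, hw⟩
  | succ n ih =>
    intro w hw
    exact NucleusSections.succ fun x => ih (hw.shiftWord.sublist (secWord_sublist w x))

variable (d) in
/-- The sections of `w` at all sufficiently deep levels are represented by words of the nucleus. -/
def Contracts (w : List (ZMod s × Bool)) : Prop :=
  ∃ N, ∀ n ≥ N, NucleusSections d n w

theorem Contracts.of_secWord {w : List (ZMod s × Bool)}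
    (h : ∀ x : Fin (d + 2), Contracts d (secWord w x)) :
    Contracts d w := by
  choose N hN using h
  refine ⟨∑ x, N x + 1, fun n hn => ?_⟩
  obtain ⟨k, rfl⟩ := Nat.exists_eq_add_of_le' (Nat.le_trans (Nat.le_add_left 1 _) hn)
  exact NucleusSections.succ fun x => hN x k
    ((Finset.single_le_sum (fun _ _ => Nat.zero_le _) (Finset.mem_univ x)).trans (by omega))

/-- A word is reduced if it contains no letter followed by its inverse. -/
def ReducedWord (w : List (ZMod s × Bool)) : Prop :=
  ∀ A B i b, w ≠ A ++ (i, b) :: (i, !b) :: B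

theorem ReducedWord.shiftWord {w : List (ZMod s × Bool)} (h : ReducedWord w) :
    ReducedWord (shiftWord w) := by
  intro A B i b hw
  obtain ⟨A', B', rfl, -, hB⟩ := List.map_eq_append_iff.1 hw
  obtain ⟨l, B₁, rfl, hl, hB₁⟩ := List.map_eq_cons_iff.1 hB
  obtain ⟨l', B₂, rfl, hl', -⟩ := List.map_eq_cons_iff.1 hB₁
  obtain ⟨j, c⟩ := l
  obtain ⟨j', c'⟩ := l'
  rw [Prod.mk.injEq] at hl hl'
  obtain rfl : j = j' := sub_left_injective (hl.1.trans hl'.1.symm)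
  obtain rfl : c = b := hl.2
  obtain rfl : c' = !c := hl'.2
  exact h A' B₂ j c rfl

/-- The letter `a_i` occurs after another letter, or `a_i⁻¹` occurs before another letter. -/
def BadIndex (i : ZMod s) (w : List (ZMod s × Bool)) : Prop :=
  ∃ A l l' B, w = A ++ l :: l' :: B ∧ (l' = (i, true) ∨ l = (i, false))

theorem BadIndex.shiftWord {w : List (ZMod s × Bool)} {i : ZMod s} (h : BadIndex i w) :
    BadIndex (i - 1) (shiftWord w) := by
  obtain ⟨A, l, l', B, rfl, h⟩ := h
  refine ⟨_, _, _, _, by simp [TreeAut.shiftWord]; rfl, h.imp ?_ ?_⟩ <;> rintro rfl <;> rfl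

/-- Without a bad index every letter but the first is an inverse and every letter but the last is
positive, which leaves only nucleus words. -/
theorem ReducedWord.exists_badIndex {w : List (ZMod s × Bool)} (h : ReducedWord w)
    (hw : ¬ NucleusWord w) : ∃ i, BadIndex i w := by
  by_contra! hbad
  match w, h, hw, hbad with
  | [], _, hw, _ => exact hw (Or.inl rfl)
  | [l], _, hw, _ => exact hw (Or.inr (Or.inl ⟨l, rfl⟩))
  | (i, b) :: (j, c) :: B, h, hw, hbad =>
    have hc : c = false := by
      cases c
      · rfl
      · exact absurd ⟨[], _, _, B, rfl, Or.inl rfl⟩ (hbad j)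
    have hb : b = true := by
      cases b
      · exact absurd ⟨[], _, _, B, rfl, Or.inr rfl⟩ (hbad i)
      · rfl
    subst hc hb
    cases B with
    | nil =>
      refine hw (Or.inr (Or.inr ⟨i, j, ?_, rfl⟩))
      rintro rfl
      exact h [] [] i true rfl
    | cons l B => exact hbad j ⟨[(i, true)], _, _, B, rfl, Or.inr rfl⟩

theorem secLetter_ne_nil {l : ZMod s × Bool} {z : Fin (d + 2)} (h : secLetter l z ≠ []) :
    z = activeLetter d l := by
  by_contra hz
  exact h (by rw [secLetter, if_neg hz])

theorem length_secLetter_le (l : ZMod s × Bool) (z : Fin (d + 2)) :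
    (secLetter l z).length ≤ 1 := (secLetter_sublist l z).length_le

/-- In a reduced word whose section at some letter has full length, `a_0` can occur only at the
beginning and `a_0⁻¹` only at the end. -/
theorem ReducedWord.not_badIndex_zero {w : List (ZMod s × Bool)} (h : ReducedWord w)
    {z : Fin (d + 2)} (hz : (secWord w z).length = w.length) : ¬ BadIndex 0 w := by
  rintro ⟨A, l, l', B, rfl, hl⟩
  rw [secWord_append, secWord, secWord] at hz
  simp only [List.length_append, List.length_cons] at hz
  have hA := length_secWord_le A (rootPerm (evalWord d (l :: l' :: B)) z)
  have hB := length_secWord_le B z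
  set p := rootPerm (evalWord d B) z with hp
  have h1 := length_secLetter_le l (rootPerm (evalWord d (l' :: B)) z)
  have h2 := length_secLetter_le l' p
  have hq : rootPerm (evalWord d (l' :: B)) z = rootPerm (evalLetter d l') p := by
    rw [evalWord_cons, rootPerm_mul, Equiv.Perm.mul_apply]
  have h3 : rootPerm (evalLetter d l') p = activeLetter d l := by
    rw [← hq]
    refine secLetter_ne_nil fun h0 => ?_
    rw [h0] at hz
    simp only [List.length_nil] at hz
    omega
  have h4 : p = activeLetter d l' := by
    refine secLetter_ne_nil fun h0 => ?_
    rw [h0] at hz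
    simp only [List.length_nil] at hz
    omega
  rw [h4] at h3
  have hne := zero_ne_last (d := d)
  -- Full length means that every letter is active when it is read, from right to left. After a_0
  -- the current letter is 0, where only a_0⁻¹ is active; and a_0⁻¹ needs the current letter 0,
  -- which only a_0 leaves behind when active. Both cases contradict reducedness.
  rcases hl with rfl | rfl
  · obtain ⟨i, b⟩ := l
    rw [activeLetter_true] at h3
    simp only [evalLetter, if_true, rootPerm_gen_zero, finRotate_last] at h3
    cases b
    · by_cases hi : i = 0
      · subst hi
        exact h A B 0 false rfl
      · rw [activeLetter_of_ne hi] at h3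
        exact hne h3
    · exact hne h3
  · obtain ⟨i, b⟩ := l'
    rw [activeLetter_zero_false] at h3
    by_cases hi : i = 0
    · subst hi
      cases b
      · rw [activeLetter_zero_false] at h3
        simp only [evalLetter, Bool.false_eq_true, if_false, rootPerm_inv, rootPerm_gen_zero,
          Equiv.Perm.inv_eq_iff_eq, finRotate_apply_eq, zero_add] at h3
        exact zero_ne_one h3
      · exact h A B 0 false rfl
    · rw [activeLetter_of_ne hi, rootPerm_evalLetter_of_ne hi] at h3
      exact hne h3.symm

/-- The group is contracting. -/
theorem contracts (w : List (ZMod s × Bool)) : Contracts d w := by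
  induction hr : w.length using Nat.strong_induction_on generalizing w with
  | _ r ih =>
    by_cases hred : ReducedWord w
    · by_cases hw : NucleusWord w
      · exact ⟨0, fun n _ => hw.nucleusSections n⟩
      obtain ⟨i, hi⟩ := hred.exists_badIndex hw
      obtain ⟨n, rfl⟩ : ∃ n : ℕ, (n : ZMod s) = i := ⟨i.val, ZMod.natCast_zmod_val i⟩
      clear hw
      -- A section is either shorter or the whole shifted word, whose bad index is one smaller. Once
      -- the bad index is 0 every section is shorter.
      induction n generalizing w with
      | zero =>
        rw [Nat.cast_zero] at hi
        refine Contracts.of_secWord fun x => ih _ ?_ _ rfl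
        rw [← hr]
        exact lt_of_le_of_ne (length_secWord_le w x) fun h => hred.not_badIndex_zero h hi
      | succ n ihn =>
        refine Contracts.of_secWord fun x => ?_
        rcases (length_secWord_le w x).lt_or_eq with h | h
        · exact ih _ (hr ▸ h) _ rfl
        · have hx : secWord w x = shiftWord w := (secWord_sublist w x).eq_of_length
            (by rw [h, shiftWord, List.length_map])
          rw [hx]
          refine ihn _ (by rw [shiftWord, List.length_map, hr]) hred.shiftWord ?_
          have := hi.shiftWord
          rwa [Nat.cast_succ, add_sub_cancel_right] at this
    · simp only [ReducedWord, not_forall, not_not] at hred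
      obtain ⟨A, B, i, b, rfl⟩ := hred
      simp only [List.length_append, List.length_cons] at hr
      obtain ⟨N, hN⟩ := ih (A ++ B).length (by rw [List.length_append]; omega) _ rfl
      exact ⟨N, fun n hn => (hN n hn).congr (evalWord_cancel A B i b).symm
        fun j => (expSum_cancel A B i j b).symm⟩

end Contraction

/-! ### Orbits of `K` on embeddings of the tree, and the linking argument. -/

section Groupoid

set_option linter.unusedSectionVars false

open scoped Fin.CommRing

variable {d s : ℕ} [NeZero s]

/-- The pairs `(i, u)` stand for the embeddings `w ↦ t_i (u w)` of the tree in itself. The embedding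
`(i, u)` is carried by an element of `K` to the embedding `(j, v)` composed with `g`. -/
def Carries (K : Subgroup (TreeAut (d + 2))) (t : ZMod s → TreeAut (d + 2)) (g : TreeAut (d + 2))
    (i : ZMod s) (u : List (Fin (d + 2))) (j : ZMod s) (v : List (Fin (d + 2))) : Prop :=
  ∃ f, t j * f * (t i)⁻¹ ∈ K ∧ f.1 u = v ∧ sectionAt f u = g

variable {K : Subgroup (TreeAut (d + 2))} {t : ZMod s → TreeAut (d + 2)} {ν : ZMod s → ZMod s}
  {g h : TreeAut (d + 2)} {i j k l : ZMod s} {u v w : List (Fin (d + 2))}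

theorem Carries.refl : Carries K t 1 i u i u :=
  ⟨1, by rw [mul_one, mul_inv_cancel]; exact one_mem K, rfl, sectionAt_one u⟩

theorem Carries.symm (hg : Carries K t g i u j v) : Carries K t g⁻¹ j v i u := by
  obtain ⟨f, hf, rfl, rfl⟩ := hg
  refine ⟨f⁻¹, ?_, inv_apply_self f u, by rw [sectionAt_inv, inv_apply_self]⟩
  have := inv_mem hf
  simpa [mul_assoc] using this

theorem Carries.trans (hg : Carries K t g i u j v) (hh : Carries K t h j v k w) :
    Carries K t (h * g) i u k w := by
  obtain ⟨f, hf, rfl, rfl⟩ := hg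
  obtain ⟨f', hf', rfl, rfl⟩ := hh
  refine ⟨f' * f, ?_, rfl, sectionAt_mul f' f u⟩
  have := mul_mem hf' hf
  simpa [mul_assoc] using this

theorem Carries.push (hg : Carries K t g i u j v) (z : Fin (d + 2)) :
    Carries K t (sectionAt g [z]) i (u ++ [z]) j (v ++ [rootPerm g z]) := by
  obtain ⟨f, hf, rfl, rfl⟩ := hg
  exact ⟨f, hf, by rw [apply_append', apply_singleton_eq], sectionAt_append f u [z]⟩

/-- Two embeddings are in the same `K`-orbit. -/
def Linked (K : Subgroup (TreeAut (d + 2))) (t : ZMod s → TreeAut (d + 2))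
    (i : ZMod s) (u : List (Fin (d + 2))) (j : ZMod s) (v : List (Fin (d + 2))) : Prop :=
  Carries K t 1 i u j v

theorem Linked.refl : Linked K t i u i u := Carries.refl

theorem Linked.symm (hg : Linked K t i u j v) : Linked K t j v i u := by
  have := Carries.symm hg
  rwa [inv_one] at this

theorem Linked.trans (hg : Linked K t i u j v) (hh : Linked K t j v k w) :
    Linked K t i u k w := by
  have := Carries.trans hg hh
  rwa [one_mul] at this

theorem Linked.push (hg : Linked K t i u j v) (z : Fin (d + 2)) :
    Linked K t i (u ++ [z]) j (v ++ [z]) := by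
  have := Carries.push hg z
  rwa [rootPerm_one, sectionAt_one] at this

theorem Linked.trans_carries (hg : Linked K t i u j v) (hh : Carries K t h j v k w) :
    Carries K t h i u k w := by
  have := Carries.trans hg hh
  rwa [mul_one] at this

theorem Carries.trans_linked (hg : Carries K t g i u j v) (hh : Linked K t j v k w) :
    Carries K t g i u k w := by
  have := Carries.trans hg hh
  rwa [one_mul] at this

variable (d) in
/-- The vertex of level `n` of the rightmost ray. -/
def lastRay (n : ℕ) : List (Fin (d + 2)) := List.replicate n (Fin.last (d + 1))

theorem lastRay_succ (n : ℕ) : lastRay d (n + 1) = lastRay d n ++ [Fin.last (d + 1)] :=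
  List.replicate_succ'

/-- The embeddings `t_i` are permuted cyclically, via the generators, by elements of `K`. -/
structure GenCycle (K : Subgroup (TreeAut (d + 2))) (t : ZMod s → TreeAut (d + 2))
    (ν : ZMod s → ZMod s) : Prop where
  edge : ∀ i, t (ν i) * gen d i * (t i)⁻¹ ∈ K
  trans : ∀ i j, ∃ k, ν^[k] i = j

theorem Carries.push_gen (hg : Carries K t (gen d l) i u j v) (hl : l ≠ 0) (z : Fin (d + 2)) :
    Carries K t (if z = Fin.last (d + 1) then gen d (l - 1) else 1) i (u ++ [z]) j (v ++ [z]) := by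
  have := hg.push z
  rwa [rootPerm_gen_of_ne hl, sectionAt_gen] at this

theorem Carries.push_gen_last (hg : Carries K t (gen d l) i u j v) (hl : l ≠ 0) :
    Carries K t (gen d (l - 1)) i (u ++ [Fin.last (d + 1)]) j (v ++ [Fin.last (d + 1)]) := by
  have := hg.push_gen hl (Fin.last (d + 1))
  rwa [if_pos rfl] at this

theorem Carries.push_gen_zero (hg : Carries K t (gen d (0 : ZMod s)) i u j v) {z : Fin (d + 2)}
    (hz : z ≠ Fin.last (d + 1)) : Linked K t i (u ++ [z]) j (v ++ [z + 1]) := by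
  have := hg.push z
  rwa [rootPerm_gen_zero, sectionAt_gen, if_neg hz, finRotate_apply_eq] at this

section Level

variable {n : ℕ}

/-- For i ≠ n the generator carried at level n has nonzero index, hence acts trivially below every
letter other than the last. Follow the cycle ν from `i` until it meets n. -/
theorem linked_of_ne_last (hν : ∀ i j, ∃ k, ν^[k] i = j)
    (he : ∀ i : ZMod s, Carries K t (gen d (i - (n : ZMod s))) i (lastRay d n) (ν i) (lastRay d n))
    {z : Fin (d + 2)} (hz : z ≠ Fin.last (d + 1)) (i j : ZMod s) :
    Linked K t i (lastRay d n ++ [z]) j (lastRay d n ++ [z]) := by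
  have h : ∀ (k : ℕ) (i : ZMod s), ν^[k] i = (n : ZMod s) →
      Linked K t i (lastRay d n ++ [z]) n (lastRay d n ++ [z]) := by
    intro k
    induction k with
    | zero => rintro i rfl; exact Linked.refl
    | succ k ih =>
      intro i hi
      by_cases hin : i = (n : ZMod s)
      · subst hin; exact Linked.refl
      · have h1 := (he i).push_gen (sub_ne_zero.2 hin) z
        rw [if_neg hz] at h1
        exact Linked.trans h1 (ih (ν i) hi)
  obtain ⟨k, hk⟩ := hν i n
  obtain ⟨k', hk'⟩ := hν j n
  exact (h k i hk).trans (h k' j hk').symm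

/-- At index n the carried generator is a_0, which moves `z` to `z + 1` with trivial section. Away
from the last letter one may return to index n after each step, so the walk ends at the last letter
with index ν(n). -/
theorem linked_lastRay_succ (hν : ∀ i j, ∃ k, ν^[k] i = j)
    (he : ∀ i : ZMod s, Carries K t (gen d (i - (n : ZMod s))) i (lastRay d n) (ν i) (lastRay d n))
    {z : Fin (d + 2)} (hz : z ≠ Fin.last (d + 1)) (i : ZMod s) :
    Linked K t i (lastRay d n ++ [z]) (ν n) (lastRay d (n + 1)) := by
  have h0 : Carries K t (gen d (0 : ZMod s)) (n : ZMod s) (lastRay d n) (ν n) (lastRay d n) := by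
    have := he n
    rwa [sub_self] at this
  have h : ∀ (k : ℕ) (z : Fin (d + 2)), z.val + k = d →
      Linked K t (n : ZMod s) (lastRay d n ++ [z]) (ν n) (lastRay d (n + 1)) := by
    intro k
    induction k with
    | zero =>
      intro z hz
      have hz' : z ≠ Fin.last (d + 1) := by
        rintro rfl
        rw [Fin.val_last] at hz
        omega
      have hz1 : z + 1 = Fin.last (d + 1) := by
        rw [Fin.ext_iff, Fin.val_add_one_of_lt (Fin.lt_last_iff_ne_last.2 hz'), Fin.val_last]
        omega
      rw [lastRay_succ, ← hz1]
      exact h0.push_gen_zero hz'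
    | succ k ih =>
      intro z hz
      have hz' : z ≠ Fin.last (d + 1) := by
        rintro rfl
        rw [Fin.val_last] at hz
        omega
      have hz1 : (z + 1).val = z.val + 1 :=
        Fin.val_add_one_of_lt (Fin.lt_last_iff_ne_last.2 hz')
      have hz2 : z + 1 ≠ Fin.last (d + 1) := by
        intro h
        rw [h, Fin.val_last] at hz1
        omega
      exact ((h0.push_gen_zero hz').trans (linked_of_ne_last hν he hz2 _ _)).trans
        (ih (z + 1) (by omega))
  have hlt : z.val < d + 1 := by
    have := Fin.lt_last_iff_ne_last.2 hz
    rwa [Fin.lt_def, Fin.val_last] at this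
  exact (linked_of_ne_last hν he hz i n).trans (h (d - z.val) z (by omega))

end Level

/-- Going down the ray lowers the index of the generator. When a_0 is reached the target becomes the
child 0, which is linked back to the ray with the same index ν(i). -/
theorem GenCycle.carries (hK : GenCycle K t ν) (n : ℕ) : ∀ i : ZMod s,
    Carries K t (gen d (i - (n : ZMod s))) i (lastRay d n) (ν i) (lastRay d n) := by
  induction n with
  | zero =>
    intro i
    exact ⟨gen d i, hK.edge i, apply_nil _, by rw [Nat.cast_zero, sub_zero]; exact sectionAt_nil _⟩
  | succ n ih =>
    intro i
    rw [Nat.cast_succ, ← sub_sub]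
    by_cases hi : i - n = 0
    · have h1 := (ih i).push (Fin.last (d + 1))
      rw [sectionAt_gen, if_pos rfl, hi, rootPerm_gen_zero, finRotate_last] at h1
      rw [hi, lastRay_succ]
      have h2 := linked_lastRay_succ hK.trans ih (zero_ne_last (d := d)) (ν i)
      rw [← sub_eq_zero.1 hi, lastRay_succ] at h2
      exact h1.trans_linked h2
    · rw [lastRay_succ]
      exact (ih i).push_gen_last hi

theorem GenCycle.linked_succ (hK : GenCycle K t ν) {n : ℕ} {z : Fin (d + 2)}
    (hz : z ≠ Fin.last (d + 1)) (i : ZMod s) :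
    Linked K t i (lastRay d n ++ [z]) (ν n) (lastRay d (n + 1)) :=
  linked_lastRay_succ hK.trans (hK.carries n) hz i

theorem GenCycle.exists_linked_lastRay (hK : GenCycle K t ν) (j : ZMod s) (n : ℕ) :
    ∀ u : List (Fin (d + 2)), u.length = n → ∃ i, Linked K t j u i (lastRay d n) := by
  induction n with
  | zero => intro u hu; exact ⟨j, by rw [List.length_eq_zero_iff.1 hu]; exact Linked.refl⟩
  | succ n ih =>
    intro u hu
    obtain ⟨v, z, rfl⟩ : ∃ v z, u = v ++ [z] :=
      ⟨_, _, (List.dropLast_append_getLast (by rintro rfl; simp at hu)).symm⟩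
    obtain ⟨i, hi⟩ := ih v (by simpa using hu)
    by_cases hz : z = Fin.last (d + 1)
    · subst hz
      exact ⟨i, by rw [lastRay_succ]; exact hi.push _⟩
    · exact ⟨_, (hi.push z).trans (hK.linked_succ hz i)⟩

/-- The equivalence relation on indices given by the orbits at level `n` of the rightmost ray. -/
def LinkedAt (K : Subgroup (TreeAut (d + 2))) (t : ZMod s → TreeAut (d + 2)) (n : ℕ)
    (i j : ZMod s) : Prop := Linked K t i (lastRay d n) j (lastRay d n)

theorem LinkedAt.mono {n n' : ℕ} (hn : n ≤ n') (h : LinkedAt K t n i j) :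
    LinkedAt K t n' i j := by
  induction n', hn using Nat.le_induction with
  | base => exact h
  | succ n' _ ih =>
    have := Linked.push ih (Fin.last (d + 1))
    rwa [← lastRay_succ] at this

/-- Links persist along the ray, and an increasing chain of relations on a finite set is eventually
constant. -/
theorem exists_linkedAt_stable (K : Subgroup (TreeAut (d + 2))) (t : ZMod s → TreeAut (d + 2)) :
    ∃ N, ∀ n, ∀ i j, LinkedAt K t n i j → LinkedAt K t N i j := by
  let S : ℕ →o Set (ZMod s × ZMod s) :=
    ⟨fun n => {p | LinkedAt K t n p.1 p.2}, fun n n' hn p hp => LinkedAt.mono hn hp⟩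
  obtain ⟨N, hN⟩ := WellFoundedGT.monotone_chain_condition S
  refine ⟨N, fun n i j h => ?_⟩
  have h1 : (i, j) ∈ S (max N n) := LinkedAt.mono (le_max_right N n) h
  rw [← hN _ (le_max_left N n)] at h1
  exact h1

/-- Descend along the ray until the carried generator is a_0, at a level congruent to `i`. Its step
from the last letter but one to the last links that child of `k` to `l`, and this child is also
linked to ν(i). -/
theorem GenCycle.linkedAt_target (hK : GenCycle K t ν) {N : ℕ}
    (hN : ∀ n, ∀ i j, LinkedAt K t n i j → LinkedAt K t N i j) (i k l : ZMod s) (c : ℕ) :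
    ∀ n : ℕ, (i - (n : ZMod s)).val = c →
      Carries K t (gen d (i - (n : ZMod s))) k (lastRay d n) l (lastRay d n) →
      LinkedAt K t N l (ν i) := by
  induction c with
  | zero =>
    intro n hc h
    have hi : i - (n : ZMod s) = 0 := (ZMod.val_eq_zero _).1 hc
    rw [hi] at h
    have hz : (Fin.last (d + 1) - 1 : Fin (d + 2)) ≠ Fin.last (d + 1) := by
      rw [Ne, sub_eq_self]
      exact one_ne_zero
    have h1 := h.push_gen_zero hz
    rw [sub_add_cancel, ← lastRay_succ] at h1
    have h2 := h1.symm.trans (hK.linked_succ hz k)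
    rw [← sub_eq_zero.1 hi] at h2
    exact hN (n + 1) _ _ h2
  | succ c ih =>
    intro n hc h
    have hi : i - (n : ZMod s) ≠ 0 := fun h0 => by simp [h0] at hc
    obtain ⟨c', hc1, hc2⟩ := exists_val_eq_succ hi
    have h1 := h.push_gen_last hi
    rw [← lastRay_succ, sub_sub, ← Nat.cast_succ] at h1
    refine ih (n + 1) ?_ h1
    rw [Nat.cast_succ, ← sub_sub, hc2]
    omega

/-- Beyond the stable level, a generator is carried only along its standard edge from `i` to ν(i),
up to links: the source follows from the target by composing with the inverse of that edge. -/
theorem GenCycle.linkedAt_of_carries_gen (hK : GenCycle K t ν) {N n : ℕ}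
    (hN : ∀ n, ∀ i j, LinkedAt K t n i j → LinkedAt K t N i j) (hn : N ≤ n) {i k l : ZMod s}
    (h : Carries K t (gen d (i - (n : ZMod s))) k (lastRay d n) l (lastRay d n)) :
    LinkedAt K t N k i ∧ LinkedAt K t N l (ν i) := by
  have h1 := hK.linkedAt_target hN i k l _ n rfl h
  refine ⟨hN n _ _ ?_, h1⟩
  have h2 := (h.trans_linked (h1.mono hn)).trans (hK.carries n i).symm
  rwa [inv_mul_cancel] at h2

/-- Here a_0⁻¹ takes the last letter to the previous one with trivial section, and the other
generator is trivial there. So the ray at `k` is linked to a child at `l` off the ray, and that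
child to ν(n). -/
theorem GenCycle.linkedAt_of_val_eq_zero (hK : GenCycle K t ν) {N n : ℕ}
    (hN : ∀ n, ∀ i j, LinkedAt K t n i j → LinkedAt K t N i j) {i j k l : ZMod s} (hij : i ≠ j)
    (hi : i - (n : ZMod s) = 0)
    (h : Carries K t (gen d (j - (n : ZMod s)) * (gen d (i - (n : ZMod s)))⁻¹)
      k (lastRay d n) l (lastRay d n)) : LinkedAt K t N k (ν i) := by
  have hj : j - (n : ZMod s) ≠ 0 := fun hj => hij (sub_left_injective (hi.trans hj.symm))
  have hz : (Fin.last (d + 1) - 1 : Fin (d + 2)) ≠ Fin.last (d + 1) := by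
    rw [Ne, sub_eq_self]
    exact one_ne_zero
  have hz' : (finRotate (d + 2))⁻¹ (Fin.last (d + 1)) = Fin.last (d + 1) - 1 := by
    rw [Equiv.Perm.inv_eq_iff_eq, finRotate_apply_eq, sub_add_cancel]
  have h1 := h.push (Fin.last (d + 1))
  rw [sectionAt_mul_letter, sectionAt_inv_letter, rootPerm_mul, rootPerm_inv, hi,
    rootPerm_gen_zero, rootPerm_gen_of_ne hj, one_mul, hz', sectionAt_gen, sectionAt_gen,
    if_neg hz, if_neg hz, inv_one, mul_one, ← lastRay_succ] at h1
  have h2 := Linked.trans h1 (hK.linked_succ hz l)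
  rw [← sub_eq_zero.1 hi] at h2
  exact hN (n + 1) _ _ h2

theorem Carries.symm_gen (h : Carries K t (gen d i * (gen d j)⁻¹) k u l v) :
    Carries K t (gen d j * (gen d i)⁻¹) l v k u := by
  have := h.symm
  rwa [mul_inv_rev, inv_inv] at this

/-- While neither index is 0 the pair descends unchanged in shape; whichever reaches 0 first decides
the alternative. -/
theorem GenCycle.linkedAt_or (hK : GenCycle K t ν) {N : ℕ}
    (hN : ∀ n, ∀ i j, LinkedAt K t n i j → LinkedAt K t N i j) {i j : ZMod s} (hij : i ≠ j)
    (k l : ZMod s) (c : ℕ) : ∀ n : ℕ, (i - (n : ZMod s)).val = c →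
      Carries K t (gen d (j - (n : ZMod s)) * (gen d (i - (n : ZMod s)))⁻¹)
        k (lastRay d n) l (lastRay d n) →
      LinkedAt K t N k (ν i) ∨ LinkedAt K t N l (ν j) := by
  induction c with
  | zero =>
    intro n hc h
    exact Or.inl (hK.linkedAt_of_val_eq_zero hN hij ((ZMod.val_eq_zero _).1 hc) h)
  | succ c ih =>
    intro n hc h
    have hi : i - (n : ZMod s) ≠ 0 := fun h0 => by simp [h0] at hc
    by_cases hj : j - (n : ZMod s) = 0
    · exact Or.inr (hK.linkedAt_of_val_eq_zero hN hij.symm hj h.symm_gen)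
    obtain ⟨c', hc1, hc2⟩ := exists_val_eq_succ hi
    have h1 := h.push (Fin.last (d + 1))
    rw [sectionAt_mul_letter, sectionAt_inv_letter, rootPerm_mul, rootPerm_inv,
      rootPerm_gen_of_ne hi, rootPerm_gen_of_ne hj, inv_one, one_mul, Equiv.Perm.one_apply,
      sectionAt_gen, sectionAt_gen, if_pos rfl, if_pos rfl, ← lastRay_succ, sub_sub, sub_sub,
      ← Nat.cast_succ] at h1
    refine ih (n + 1) ?_ h1
    rw [Nat.cast_succ, ← sub_sub, hc2]
    omega

theorem LinkedAt.symm {n : ℕ} (h : LinkedAt K t n i j) : LinkedAt K t n j i := Linked.symm h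

theorem LinkedAt.trans {n : ℕ} (h : LinkedAt K t n i j) (h' : LinkedAt K t n j k) :
    LinkedAt K t n i k := Linked.trans h h'

/-- Composing with the standard edge of the inverted generator leaves a single generator carried
from `i` to `l`. -/
theorem GenCycle.linkedAt_of_source (hK : GenCycle K t ν) {N n : ℕ}
    (hN : ∀ n, ∀ i j, LinkedAt K t n i j → LinkedAt K t N i j) (hn : N ≤ n) {i j k l : ZMod s}
    (h : Carries K t (gen d (j - (n : ZMod s)) * (gen d (i - (n : ZMod s)))⁻¹)
      k (lastRay d n) l (lastRay d n)) (hk : LinkedAt K t N k (ν i)) :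
    LinkedAt K t N i j ∧ LinkedAt K t N l (ν j) := by
  have h1 := ((hK.carries n i).trans_linked (hk.symm.mono hn)).trans h
  rw [inv_mul_cancel_right] at h1
  exact hK.linkedAt_of_carries_gen hN hn h1

theorem GenCycle.linkedAt_of_carries_pair (hK : GenCycle K t ν) {N n : ℕ}
    (hN : ∀ n, ∀ i j, LinkedAt K t n i j → LinkedAt K t N i j) (hn : N ≤ n) {i j k l : ZMod s}
    (hij : i ≠ j)
    (h : Carries K t (gen d (j - (n : ZMod s)) * (gen d (i - (n : ZMod s)))⁻¹)
      k (lastRay d n) l (lastRay d n)) :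
    LinkedAt K t N k (ν i) ∧ LinkedAt K t N i j ∧ LinkedAt K t N l (ν j) := by
  rcases hK.linkedAt_or hN hij k l _ n rfl h with hk | hl
  · exact ⟨hk, hK.linkedAt_of_source hN hn h hk⟩
  · obtain ⟨h1, h2⟩ := hK.linkedAt_of_source hN hn h.symm_gen hl
    exact ⟨h2, h1.symm, hl⟩

open Classical in
/-- The indicator function of the class of `b`. -/
noncomputable def classIndicator (K : Subgroup (TreeAut (d + 2))) (t : ZMod s → TreeAut (d + 2))
    (N : ℕ) (b i : ZMod s) : ℤ := if LinkedAt K t N b i then 1 else 0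

theorem classIndicator_congr {N : ℕ} (b : ZMod s) (h : LinkedAt K t N i j) :
    classIndicator K t N b i = classIndicator K t N b j := by
  have : LinkedAt K t N b i ↔ LinkedAt K t N b j :=
    ⟨fun h' => h'.trans h, fun h' => h'.trans h.symm⟩
  rw [classIndicator, classIndicator, this]

/-- The change of the class indicator along a word at level `n`. -/
noncomputable def classChange (K : Subgroup (TreeAut (d + 2))) (t : ZMod s → TreeAut (d + 2))
    (ν : ZMod s → ZMod s) (N : ℕ) (b : ZMod s) (n : ℕ) (w : List (ZMod s × Bool)) : ℤ :=
  ∑ i, (classIndicator K t N b (ν i) - classIndicator K t N b i) * expSum w (i - (n : ZMod s))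

theorem classChange_singleton (N : ℕ) (b : ZMod s) (n : ℕ) (j : ZMod s) (c : Bool) :
    classChange K t ν N b n [(j - (n : ZMod s), c)] = (if c then 1 else -1) *
      (classIndicator K t N b (ν j) - classIndicator K t N b j) := by
  rw [classChange, Finset.sum_eq_single j]
  · rw [expSum_singleton, if_pos rfl, mul_comm]
  · intro i _ hi
    rw [expSum_singleton, if_neg fun h => hi (sub_left_injective h).symm, mul_zero]
  · exact fun h => absurd (Finset.mem_univ j) h

theorem classChange_append (N : ℕ) (b : ZMod s) (n : ℕ) (v w : List (ZMod s × Bool)) :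
    classChange K t ν N b n (v ++ w) =
      classChange K t ν N b n v + classChange K t ν N b n w := by
  simp only [classChange, expSum_append, mul_add, Finset.sum_add_distrib]

/-- This is where the short list of nucleus words matters: for a pair a_j a_i⁻¹ the intermediate
indices `i` and `j` are linked, so their indicators cancel. -/
theorem GenCycle.classChange_eq (hK : GenCycle K t ν) {N n : ℕ}
    (hN : ∀ n, ∀ i j, LinkedAt K t n i j → LinkedAt K t N i j) (hn : N ≤ n) (b : ZMod s)
    {w : List (ZMod s × Bool)} (hw : NucleusWord w) {k l : ZMod s}
    (h : Carries K t (evalWord d w) k (lastRay d n) l (lastRay d n)) :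
    classChange K t ν N b n w = classIndicator K t N b l - classIndicator K t N b k := by
  rcases hw with rfl | ⟨⟨i, c⟩, rfl⟩ | ⟨j, i, hij, rfl⟩
  · rw [classIndicator_congr b (hN n _ _ h)]
    simp [classChange]
  · obtain ⟨i, rfl⟩ : ∃ i', i = i' - (n : ZMod s) := ⟨i + n, by ring⟩
    rw [classChange_singleton]
    cases c
    · have h1 : Carries K t (gen d (i - (n : ZMod s))) l (lastRay d n) k (lastRay d n) := by
        have := h.symm
        simpa [evalLetter] using this
      obtain ⟨h2, h3⟩ := hK.linkedAt_of_carries_gen hN hn h1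
      rw [classIndicator_congr b h2, classIndicator_congr b h3]
      simp
    · have h1 : Carries K t (gen d (i - (n : ZMod s))) k (lastRay d n) l (lastRay d n) := by
        simpa [evalLetter] using h
      obtain ⟨h2, h3⟩ := hK.linkedAt_of_carries_gen hN hn h1
      rw [classIndicator_congr b h2, classIndicator_congr b h3]
      simp
  · obtain ⟨i, rfl⟩ : ∃ i', i = i' - (n : ZMod s) := ⟨i + n, by ring⟩
    obtain ⟨j, rfl⟩ : ∃ j', j = j' - (n : ZMod s) := ⟨j + n, by ring⟩
    have h1 : Carries K t (gen d (j - (n : ZMod s)) * (gen d (i - (n : ZMod s)))⁻¹)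
        k (lastRay d n) l (lastRay d n) := by
      simpa [evalLetter] using h
    obtain ⟨h2, h3, h4⟩ := hK.linkedAt_of_carries_pair hN hn (by rintro rfl; exact hij rfl) h1
    rw [← List.singleton_append, classChange_append, classChange_singleton, classChange_singleton,
      classIndicator_congr b h2, classIndicator_congr b h3, classIndicator_congr b h4]
    simp

/-- If `K` meets every coset of the commutator subgroup, all indices get linked. -/
theorem GenCycle.exists_linkedAt (hK : GenCycle K t ν) {b : ZMod s} (hb : t b = 1)
    (hgen : ∀ i, ∃ w : List (ZMod s × Bool), evalWord d w ∈ K ∧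
      ∀ j, expSum w j = if j = i then 1 else 0) : ∃ n, ∀ i, LinkedAt K t n b i := by
  obtain ⟨N, hN⟩ := exists_linkedAt_stable K t
  refine ⟨N, ?_⟩
  have hstep : ∀ i, classIndicator K t N b (ν i) = classIndicator K t N b i := by
    intro i
    obtain ⟨w, hw, hwe⟩ := hgen i
    obtain ⟨M, hM⟩ := contracts (d := d) w
    obtain ⟨W, hW, hWe⟩ := hM (max M N) (le_max_left _ _)
    set n := max M N with hn
    choose! κ hκ using hK.exists_linked_lastRay b n
    have hchange : ∀ u : List (Fin (d + 2)), u.length = n → classChange K t ν N b n (W u) =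
        classIndicator K t N b (κ ((evalWord d w).1 u)) - classIndicator K t N b (κ u) := by
      intro u hu
      refine hK.classChange_eq hN (le_max_right _ _) b (hW u hu).2 ?_
      have h1 : Carries K t (evalWord d (W u)) b u b ((evalWord d w).1 u) :=
        ⟨evalWord d w, by simpa [hb] using hw, rfl, (hW u hu).1.symm⟩
      exact ((hκ u hu).symm.trans_carries h1).trans_linked (hκ _ (by rw [length_apply, hu]))
    -- Summing over the level, the right side vanishes because `w` permutes the vertices. On the
    -- left the exponent sums of the sections add up to those of `w`, leaving only the change of the
    -- indicator from i to ν(i).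
    have h1 := levelSum_congr hchange
    rw [levelSum_sub, levelSum_comp n (fun u => classIndicator K t N b (κ u)), sub_self] at h1
    simp only [classChange] at h1
    rw [levelSum_sum] at h1
    simp only [levelSum_mul_left, hWe, sub_add_cancel, hwe, mul_ite, mul_one, mul_zero,
      Finset.sum_ite_eq', Finset.mem_univ, if_true] at h1
    exact sub_eq_zero.1 h1
  intro i
  obtain ⟨k, rfl⟩ := hK.trans b i
  have h1 : classIndicator K t N b (ν^[k] b) = classIndicator K t N b b := by
    induction k with
    | zero => rfl
    | succ k ih => rw [Function.iterate_succ_apply', hstep, ih]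
  by_contra h
  rw [classIndicator, classIndicator, if_neg h,
    if_pos (show LinkedAt K t N b b from Linked.refl)] at h1
  exact zero_ne_one h1

/-- With all indices linked to `b`, every standard edge becomes a loop at `b`. Since t_b = 1, its
generator is a section of an element of `K` itself. -/
theorem GenCycle.exists_secGroup_eq (hK : GenCycle K t ν) (hKG : K ≤ genGroup d s) {b : ZMod s}
    (hb : t b = 1) (hgen : ∀ i, ∃ w : List (ZMod s × Bool), evalWord d w ∈ K ∧
      ∀ j, expSum w j = if j = i then 1 else 0) : ∃ u, secGroup K u = genGroup d s := by
  obtain ⟨n, hn⟩ := hK.exists_linkedAt hb hgen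
  refine ⟨lastRay d n, le_antisymm (secGroup_le hKG _) ((Subgroup.closure_le _).2 ?_)⟩
  rintro _ ⟨i, rfl⟩
  obtain ⟨i, rfl⟩ : ∃ i', i = i' - (n : ZMod s) := ⟨i + n, by ring⟩
  obtain ⟨f, hf, hfu, hfs⟩ :=
    (Linked.trans_carries (hn i) (hK.carries n i)).trans_linked (Linked.symm (hn (ν i)))
  exact ⟨f, by simpa [hb] using hf, hfu, hfs⟩

end Groupoid

/-! ### Assembling the argument. -/

section Prodense

set_option linter.unusedSectionVars false

variable {d s : ℕ} [NeZero s]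

theorem _root_.Subgroup.ProdenseIn.secGroup (hs : 2 ≤ s) (u : List (Fin (d + 2))) :
    ∀ {H : Subgroup (TreeAut (d + 2))}, H.ProdenseIn (genGroup d s) →
      (secGroup H u).ProdenseIn (genGroup d s) := by
  induction u with
  | nil => intro H hH; rwa [secGroup_nil]
  | cons x u ih => intro H hH; rw [secGroup_cons]; exact ih (hH.secGroup_letter hs x)

theorem _root_.Subgroup.ProdenseIn.comap_conj {Γ : Type*} [Group Γ] {H G : Subgroup Γ}
    (hH : H.ProdenseIn G) {g : Γ} (hg : g ∈ G) :
    (H.comap (MulAut.conj g).toMonoidHom).ProdenseIn G := by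
  refine ⟨fun f hf => ?_, fun N hN hNn hN1 f hf => ?_⟩
  · have h1 : g * f * g⁻¹ ∈ G := hH.1 hf
    have := mul_mem (mul_mem (inv_mem hg) h1) hg
    simpa [mul_assoc] using this
  · obtain ⟨h, hh, hn⟩ := hH.2 N hN hNn hN1 (g * f * g⁻¹) (mul_mem (mul_mem hg hf) (inv_mem hg))
    refine ⟨g⁻¹ * h * g, ?_, ?_⟩
    · change g * (g⁻¹ * h * g) * g⁻¹ ∈ H
      simpa [mul_assoc] using hh
    · have := hNn _ (inv_mem hg) _ hn
      simpa [mul_assoc] using this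

/-- A word in which every generator occurs exactly once yields a cycle of embeddings. -/
theorem exists_genCycle {K : Subgroup (TreeAut (d + 2))} {w : List (ZMod s × Bool)}
    (hw : evalWord d w ∈ K) (hcount : ∀ i, w.count (i, false) = 0 ∧ w.count (i, true) = 1) :
    ∃ (t : ZMod s → TreeAut (d + 2)) (ν : ZMod s → ZMod s) (b : ZMod s),
      GenCycle K t ν ∧ t b = 1 := by
  have hmem : ∀ i, (i, true) ∈ w := fun i =>
    List.count_pos_iff.1 (by rw [(hcount i).2]; exact one_pos)
  have hnodup : w.Nodup := by
    rw [List.nodup_iff_count_le_one]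
    rintro ⟨i, b⟩
    cases b
    · rw [(hcount i).1]; exact zero_le_one
    · exact (hcount i).2.le
  have htrue : ∀ l ∈ w, l = (l.1, true) := by
    rintro ⟨i, b⟩ hl
    cases b
    · exact absurd (hcount i).1 (List.count_pos_iff.2 hl).ne'
    · rfl
  have : NeZero w.length := ⟨fun h => by
    have := hmem 0
    rw [List.length_eq_zero_iff.1 h] at this
    exact absurd this List.not_mem_nil⟩
  let lab : ZMod w.length → ZMod s := fun q => (w[q.val]'(ZMod.val_lt q)).1
  let pos : ZMod s → ZMod w.length := fun i => (w.idxOf (i, true) : ℕ)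
  have hpos : ∀ i, (pos i).val = w.idxOf (i, true) := fun i =>
    ZMod.val_cast_of_lt (List.idxOf_lt_length_of_mem (hmem i))
  have hlab : ∀ q : ZMod w.length, w[q.val]'(ZMod.val_lt q) = (lab q, true) := fun q =>
    htrue _ (List.getElem_mem _)
  have hpl : ∀ q, pos (lab q) = q := fun q => by
    apply ZMod.val_injective
    rw [hpos, ← hlab, hnodup.idxOf_getElem]
  have hlp : ∀ i, lab (pos i) = i := fun i => by
    have h1 : w[(pos i).val]'(ZMod.val_lt _) = (i, true) := by
      simp only [hpos, List.getElem_idxOf]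
    exact congrArg Prod.fst h1
  let T : ℕ → TreeAut (d + 2) := fun k => evalWord d (w.take k)
  have hT : ∀ q : ZMod w.length, T (q.val + 1) = T q.val * gen d (lab q) := fun q => by
    change evalWord d (w.take (q.val + 1)) = _
    rw [List.take_succ_eq_append_getElem (ZMod.val_lt q), evalWord_append, hlab]
    simp [evalLetter, T]
  -- With positions taken cyclically, t_i is the prefix ending with a_i and t_{ν(i)} the prefix just
  -- before it, so the edge is trivial except at the final position. There the prefix wraps to the
  -- empty one and the edge is the whole product, which lies in `K`.
  refine ⟨fun i => T (pos i + 1).val, fun i => lab (pos i - 1), lab (-1),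
    ⟨fun i => ?_, fun i j => ?_⟩, ?_⟩
  · rw [hpl, sub_add_cancel]
    have h1 := hT (pos i)
    rw [hlp] at h1
    rw [← h1]
    by_cases h : pos i + 1 = 0
    · have h2 : (pos i).val + 1 = w.length := by
        have := val_zero_sub_one (s := w.length)
        rw [← h, add_sub_cancel_right] at this
        rw [this]
        have := NeZero.pos w.length
        omega
      rw [h, h2, ZMod.val_zero]
      simpa [T] using hw
    · obtain ⟨k, hk, hk'⟩ := exists_val_eq_succ h
      rw [add_sub_cancel_right] at hk'
      rw [hk, hk', mul_inv_cancel]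
      exact one_mem K
  · have hiter : ∀ (k : ℕ) (i : ZMod s), (fun i => lab (pos i - 1))^[k] i = lab (pos i - k) := by
      intro k
      induction k with
      | zero => intro i; rw [Nat.cast_zero, sub_zero, hlp]; rfl
      | succ k ih =>
        intro i
        rw [Function.iterate_succ_apply', ih, hpl]
        congr 1
        push_cast
        ring
    refine ⟨(pos i - pos j).val, ?_⟩
    rw [hiter, ZMod.natCast_zmod_val, sub_sub_cancel, hlp]
  · change T (pos (lab (-1)) + 1).val = 1
    rw [hpl, neg_add_cancel, ZMod.val_zero]
    rfl

/-- The generalised Basilica group of the odometer has no proper prodense subgroup. -/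
theorem eq_of_prodenseIn (hs : 2 ≤ s) {H : Subgroup (TreeAut (d + 2))}
    (hH : H.ProdenseIn (genGroup d s)) : H = genGroup d s := by
  obtain ⟨w, ⟨-, u, g, hg, hu⟩, hcount⟩ := hH.exists_occurs hs
  refine eq_of_secGroup_eq hs u hH ?_
  have hK := (hH.secGroup hs u).comap_conj hg
  set K := (secGroup H u).comap (MulAut.conj g).toMonoidHom with hKdef
  obtain ⟨t, ν, b, hcyc, hb⟩ := exists_genCycle (K := K) hu hcount
  obtain ⟨v, hv⟩ := hcyc.exists_secGroup_eq hK.1 hb fun i => by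
    obtain ⟨w', hw', hwe⟩ := hK.exists_evalWord_mem hs [(i, true)]
    exact ⟨w', hw', fun j => by rw [hwe, expSum_singleton]; simp [eq_comm]⟩
  -- The first lift gives K = G. Undoing the conjugation makes the section group of `H` at `u` full,
  -- as the second lift, set up above, requires.
  have hKG := eq_of_secGroup_eq hs v hK hv
  refine le_antisymm (secGroup_le hH.1 u) fun x hx => ?_
  have h1 : g⁻¹ * x * g ∈ K := by
    rw [hKG]
    exact mul_mem (mul_mem (inv_mem hg) hx) hg
  have h2 : g * (g⁻¹ * x * g) * g⁻¹ ∈ secGroup H u := h1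
  simpa [mul_assoc] using h2

end Prodense

end TreeAut

/-- A prodense subgroup of a subgroup `G` is prodense in the sense of the ambient group. -/
theorem IsProdense.prodenseIn {Γ : Type*} [Group Γ] {G : Subgroup Γ} {H : Subgroup G}
    (hH : IsProdense H) : (H.map G.subtype).ProdenseIn G := by
  refine ⟨Subgroup.map_subtype_le H, fun N hN hNn hN1 g hg => ?_⟩
  have hnormal : (N.subgroupOf G).Normal := ⟨fun n hn f => hNn f.1 f.2 n.1 hn⟩
  have hbot : N.subgroupOf G ≠ ⊥ := by
    obtain ⟨n, hn, hn1⟩ := (Subgroup.bot_or_exists_ne_one N).resolve_left hN1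
    refine (Subgroup.ne_bot_iff_exists_ne_one).2 ⟨⟨⟨n, hN hn⟩, hn⟩, fun h => hn1 ?_⟩
    exact congrArg (fun x : N.subgroupOf G => (x.1 : Γ)) h
  have hmem : (⟨g, hg⟩ : G) ∈ (H : Set G) * (N.subgroupOf G : Set G) := by
    rw [hH _ hnormal hbot]
    exact Set.mem_univ _
  obtain ⟨h, hh, n, hn, hprod⟩ := Set.mem_mul.1 hmem
  refine ⟨h, ⟨h, hh, rfl⟩, ?_⟩
  have hgn : g = h.1 * n.1 := congrArg Subtype.val hprod.symm
  rw [hgn, inv_mul_cancel_left]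
  exact hn

theorem theorem4p5 (m s : ℕ) (hm : 2 ≤ m) (hs : 2 ≤ s)
    (H : Subgroup (TreeAut.basilica s (TreeAut.odometerGroup m))) (hH : IsProdense H) :
    H = ⊤ := by
  obtain ⟨d, rfl⟩ := Nat.exists_eq_add_of_le' hm
  have : NeZero s := ⟨by omega⟩
  have key : ∀ {K L : Subgroup (TreeAut (d + 2))}, K.ProdenseIn L → L = TreeAut.genGroup d s →
      K = L := by
    rintro K _ h rfl
    exact TreeAut.eq_of_prodenseIn hs h
  have h2 := key hH.prodenseIn TreeAut.basilica_odometerGroup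
  refine (Subgroup.eq_top_iff' H).2 fun x => ?_
  have hx : x.1 ∈ H.map (TreeAut.basilica s (TreeAut.odometerGroup (d + 2))).subtype := by
    rw [h2]
    exact x.2
  obtain ⟨y, hy, hyx⟩ := hx
  rwa [← Subtype.ext hyx]
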